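/- Let $X$ be a smooth real manifold of dimension $n$ (for instance a small neighbourhood of a point). Let $L$ be a smooth operator field (a $(1,1)$-tensor field) on $X$ that is Nijenhuis, i.e. $L^2[\xi,\eta]+[L\xi,L\eta]-L[L\xi,\eta]-L[\xi,L\eta]=0$ for all vector fields $\xi,\eta$; that is $\mathrm{gl}$-regular, i.e. at every point each complex eigenvalue of $L$ has geometric multiplicity one; and that is constant in suitable local coordinates around every point. Let $M$ be a smooth operator field that is a symmetry of $L$, i.e. $LM=ML$ and $M[L\xi,\xi]+L[\xi,M\xi]-[L\xi,M\xi]=0$ for all vector fields $\xi$. Then $M$ has a unique expansion $$M=g_1L^{n-1}+\dots+g_n\,\mathrm{Id}$$ with functions $g_1,\dots,g_n$. Assume that the symmetry $M$ is regular, i.e. $\mathrm dg_1,\dots,\mathrm dg_n$ are linearly independent at every point, and put $$T_M=\mathrm dg_1\otimes L^{n-1}+\dots+\mathrm dg_n\otimes\mathrm{Id},\qquad \xi\circ\eta=T_M(\xi,\eta).$$ Then there exists a unique smooth vector field $e$ on $X$ such that 1. $e$ is cyclic for $L$, i.e. $e,Le,\dots,L^{n-1}e$ are linearly independent at every point; 2.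 $\mathcal L_eL=0$; 3. $\mathcal L_eM=\mathrm{Id}$. Moreover, $(X,\circ,e,E)$ with $E=Me$ is an F-manifold: $\circ$ is a commutative associative product on vector fields with unity $e$; with $P_\xi(\zeta,\theta)=[\xi,\zeta\circ\theta]-[\xi,\zeta]\circ\theta-\zeta\circ[\xi,\theta]$ one has $$P_{\xi\circ\eta}(\zeta,\theta)=\xi\circ P_\eta(\zeta,\theta)+\eta\circ P_\xi(\zeta,\theta)$$ for all vector fields $\xi,\eta,\zeta,\theta$; and $E$ is an Euler vector field, i.e. $[E,\xi\circ\eta]-[E,\xi]\circ\eta-\xi\circ[E,\eta]=\xi\circ\eta$ for all vector fields $\xi,\eta$. In particular, $M$ is a Nijenhuis operator, so $(M,e)$ is a Nijenhuis operator with unity. -/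

import Mathlib

open scoped Manifold ContDiff
open Bundle

noncomputable section

namespace NijenhuisF

/-- Model space of an `n`-dimensional real manifold. -/
abbrev Model (n : ℕ) : Type := EuclideanSpace ℝ (Fin n)

section Manifold

variable {n : ℕ} {X : Type*} [TopologicalSpace X] [ChartedSpace (Model n) X]
  [IsManifold 𝓘(ℝ, Model n) ∞ X]

/-- The tangent space at `x`. -/
abbrev Tan (n : ℕ) {X : Type*} [TopologicalSpace X] [ChartedSpace (Model n) X] (x : X) : Type :=
  TangentSpace 𝓘(ℝ, Model n) x

/-- Vector fields on `X` (smoothness is a separate condition). -/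
abbrev VField (n : ℕ) (X : Type*) [TopologicalSpace X] [ChartedSpace (Model n) X] : Type _ :=
  (x : X) → Tan n x

/-- Operator fields, i.e. `(1,1)`-tensor fields (smoothness is a separate condition). -/
abbrev OpField (n : ℕ) (X : Type*) [TopologicalSpace X] [ChartedSpace (Model n) X] : Type _ :=
  (x : X) → Tan n x →L[ℝ] Tan n x

/-- Tensor fields of type `(1,2)` (smoothness is a separate condition). -/
abbrev BilField (n : ℕ) (X : Type*) [TopologicalSpace X] [ChartedSpace (Model n) X] : Type _ :=
  (x : X) → Tan n x →L[ℝ] Tan n x →L[ℝ] Tan n x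

/-- The vector field `V` is smooth on the set `U`. -/
def SmoothVFieldOn (V : VField n X) (U : Set X) : Prop :=
  ContMDiffOn 𝓘(ℝ, Model n) 𝓘(ℝ, Model n).tangent ∞
    (fun x => (⟨x, V x⟩ : TangentBundle 𝓘(ℝ, Model n) X)) U

/-- The vector field `V` is smooth on `X`. -/
def SmoothVField (V : VField n X) : Prop :=
  ContMDiff 𝓘(ℝ, Model n) 𝓘(ℝ, Model n).tangent ∞
    (fun x => (⟨x, V x⟩ : TangentBundle 𝓘(ℝ, Model n) X))

/-- The operator field `A` is a smooth section of the bundle `End (TX)`. -/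
def SmoothOpField (A : OpField n X) : Prop :=
  ContMDiff 𝓘(ℝ, Model n) (𝓘(ℝ, Model n).prod 𝓘(ℝ, Model n →L[ℝ] Model n)) ∞
    (fun x => TotalSpace.mk' (Model n →L[ℝ] Model n)
      (E := fun x : X => (Tan n x →L[ℝ] Tan n x)) x (A x))

/-- The commutator of vector fields. -/
abbrev bracket (V W : VField n X) : VField n X :=
  VectorField.mlieBracket 𝓘(ℝ, Model n) V W

/-- An operator field applied to a vector field. -/
abbrev app (A : OpField n X) (V : VField n X) : VField n X := fun x => A x (V x)

/-- The product of two vector fields defined by a tensor field of type `(1,2)`. -/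
abbrev prod (a : BilField n X) (V W : VField n X) : VField n X := fun x => a x (V x) (W x)

/-- The differential of a function. -/
def differential (f : X → ℝ) (x : X) : Tan n x →L[ℝ] ℝ :=
  mfderiv 𝓘(ℝ, Model n) 𝓘(ℝ, ℝ) f x

/-- Vanishing of the Nijenhuis torsion
`L² [V, W] + [L V, L W] - L [L V, W] - L [V, L W]` for all (local) smooth vector fields. -/
def IsNijenhuis (L : OpField n X) : Prop :=
  ∀ U : Set X, IsOpen U → ∀ V W : VField n X, SmoothVFieldOn V U → SmoothVFieldOn W U →
    ∀ x ∈ U,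
      L x (L x (bracket V W x)) + bracket (app L V) (app L W) x
        - L x (bracket (app L V) W x) - L x (bracket V (app L W) x) = 0

/-- Every eigenvalue of the complexification of each `L x` has geometric multiplicity one. -/
def IsGlRegular (L : OpField n X) : Prop :=
  ∀ (x : X) (μ : ℂ),
    Module.End.HasEigenvalue (((L x : Tan n x →ₗ[ℝ] Tan n x)).baseChange ℂ) μ →
      Module.finrank ℂ
        (Module.End.eigenspace (((L x : Tan n x →ₗ[ℝ] Tan n x)).baseChange ℂ) μ) = 1

/-- Around every point there are smooth local coordinates in which the matrix of `L`
is constant. -/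
def IsConstantInCoordinates (L : OpField n X) : Prop :=
  ∀ p : X, ∃ φ ∈ IsManifold.maximalAtlas 𝓘(ℝ, Model n) ∞ X, p ∈ φ.source ∧
    ∃ A : Model n →L[ℝ] Model n, ∀ x ∈ φ.source, ∀ v : Tan n x,
      mfderiv 𝓘(ℝ, Model n) 𝓘(ℝ, Model n) φ x (L x v)
        = A (mfderiv 𝓘(ℝ, Model n) 𝓘(ℝ, Model n) φ x v)

/-- The tensor `⟨L, M⟩ (V, W) = M [L V, W] + L [V, M W] - [L V, M W] - L M [V, W]`
of commuting operator fields. -/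
def nijBracket (L M : OpField n X) (V W : VField n X) : VField n X := fun x =>
  M x (bracket (app L V) W x) + L x (bracket V (app M W) x)
    - bracket (app L V) (app M W) x - L x (M x (bracket V W x))

/-- `M` is a symmetry of `L`: they commute and `⟨L, M⟩ (V, V) = 0` for all (local) smooth
vector fields `V`. -/
def IsSymmetry (L M : OpField n X) : Prop :=
  (∀ x v, L x (M x v) = M x (L x v)) ∧
  ∀ U : Set X, IsOpen U → ∀ V : VField n X, SmoothVFieldOn V U →
    ∀ x ∈ U, nijBracket L M V V x = 0

/-- The numbers `c i` are the coefficients of `M x` in `Id, L x, …, (L x) ^ (n - 1)`, highest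
power first. -/
def IsExpansionAt (L M : OpField n X) (x : X) (c : Fin n → ℝ) : Prop :=
  M x = ∑ i : Fin n, c i • (L x) ^ (n - 1 - (i : ℕ))

open Classical in
/-- The coefficient functions `g_i` in `M = g_0 L ^ (n - 1) + ⋯ + g_{n-1} Id`. If `L` is
gl-regular and commutes with `M`, they exist and are unique; the value `0` is used
where there is no such expansion. -/
def coeff (L M : OpField n X) (i : Fin n) (x : X) : ℝ :=
  if h : ∃ c : Fin n → ℝ, IsExpansionAt L M x c then h.choose i else 0

/-- `M` is a regular symmetry of `L`: the differentials of the coefficient functions are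
linearly independent at every point. -/
def IsRegularSymmetry (L M : OpField n X) : Prop :=
  IsSymmetry L M ∧
  ∀ x : X, LinearIndependent ℝ (fun i : Fin n => differential (n := n) (coeff L M i) x)

/-- `T_M = d g_0 ⊗ L ^ (n - 1) + ⋯ + d g_{n-1} ⊗ Id`. -/
def symmetryTensor (L M : OpField n X) : BilField n X := fun x =>
  ∑ i : Fin n,
    (differential (n := n) (coeff L M i) x).smulRight ((L x) ^ (n - 1 - (i : ℕ)))

/-- `e, L e, …, L ^ (n - 1) e` are linearly independent at every point. -/
def IsCyclic (L : OpField n X) (e : VField n X) : Prop :=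
  ∀ x : X, LinearIndependent ℝ (fun k : Fin n => ((L x) ^ (k : ℕ)) (e x))

/-- The Lie derivative of `A` along `e` is `B`, i.e. `[e, A V] - A [e, V] = B V` for all
(local) smooth vector fields `V`. -/
def LieDerivEq (e : VField n X) (A B : OpField n X) : Prop :=
  ∀ U : Set X, IsOpen U → ∀ V : VField n X, SmoothVFieldOn V U → ∀ x ∈ U,
    bracket e (app A V) x - A x (bracket e V x) = B x (V x)

/-- `e` is a smooth vector field, cyclic for `L`, whose Lie derivatives satisfy
`𝓛_e L = 0` and `𝓛_e M = Id`. -/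
structure IsUnityFor (L M : OpField n X) (e : VField n X) : Prop where
  smooth : SmoothVField e
  cyclic : IsCyclic L e
  lie_L : LieDerivEq e L (fun _ => 0)
  lie_M : LieDerivEq e M (fun x => ContinuousLinearMap.id ℝ (Tan n x))

/-- `(X, ∘, e, E)` is an F-manifold, where `V ∘ W = a (V, W)`: the product is smooth,
commutative and associative with unity `e`, it satisfies the Hertling–Manin condition
`P_{ξ∘η}(ζ, θ) = ξ ∘ P_η(ζ, θ) + η ∘ P_ξ(ζ, θ)` with
`P_ξ(ζ, θ) = [ξ, ζ∘θ] - [ξ, ζ]∘θ - ζ∘[ξ, θ]`, and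
`E` is an Euler vector field. -/
structure IsFManifold (a : BilField n X) (e E : VField n X) : Prop where
  smooth_mul : ∀ U : Set X, IsOpen U → ∀ V W : VField n X,
    SmoothVFieldOn V U → SmoothVFieldOn W U → SmoothVFieldOn (prod a V W) U
  smooth_unity : SmoothVField e
  smooth_euler : SmoothVField E
  comm : ∀ x u v, a x u v = a x v u
  assoc : ∀ x u v w, a x (a x u v) w = a x u (a x v w)
  unity : ∀ x v, a x (e x) v = v
  hertling_manin : ∀ U : Set X, IsOpen U → ∀ ξ η ζ θ : VField n X,
    SmoothVFieldOn ξ U → SmoothVFieldOn η U → SmoothVFieldOn ζ U → SmoothVFieldOn θ U →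
    ∀ x ∈ U,
      bracket (prod a ξ η) (prod a ζ θ) x
        - a x (bracket (prod a ξ η) ζ x) (θ x)
        - a x (ζ x) (bracket (prod a ξ η) θ x)
        - a x (ξ x) (bracket η (prod a ζ θ) x)
        + a x (a x (ξ x) (bracket η ζ x)) (θ x)
        + a x (a x (ξ x) (ζ x)) (bracket η θ x)
        - a x (η x) (bracket ξ (prod a ζ θ) x)
        + a x (a x (η x) (bracket ξ ζ x)) (θ x)
        + a x (a x (η x) (ζ x)) (bracket ξ θ x) = 0
  euler : ∀ U : Set X, IsOpen U → ∀ ξ η : VField n X,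
    SmoothVFieldOn ξ U → SmoothVFieldOn η U → ∀ x ∈ U,
      bracket E (prod a ξ η) x - a x (bracket E ξ x) (η x) - a x (ξ x) (bracket E η x)
        = a x (ξ x) (η x)

end Manifold

end NijenhuisF

end

/-! In coordinates where `L` is a constant matrix `A`, everything is modelled on the commutative
algebra R = ℝ[A], with generator a corresponding to `A`. By gl-regularity `L` has a cyclic vector in
each tangent space (`exists_cyclic_vector`), so the operators commuting with `L` are the polynomials
in `L` of degree below n, and 1, a, …, a^(n-1) is a basis of R.

Consider the R-valued function F = Σ g_i a^(n-1-i), called `symbol`. Testing the symmetry condition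
on constant fields gives L T_M(u,u) = T_M(Lu,u) (`IsConstantChart.tensor_diag`). As T_M is L-linear
in the second argument, polarisation and a cyclic vector make it L-linear in the first as well
(`bilin_linear_left_of_diag`); this says dF(Lu) = a dF(u). Regularity of `M` makes dF bijective
(`IsConstantChart.algebraChart`).

Thus F is a local coordinate with values in R in which `L` is multiplication by the constant a, `M`
is multiplication by the coordinate F itself, and T_M is the product of R. The unity is the constant
field 1, and E = Me has component F. Each identity is checked by applying the injective dF, using
dF[V,W] = V(WF) - W(VF) (`mvfderiv_bracket`) and the Leibniz rule, and computing in a commutative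
ring. Conversely, the two Lie derivative conditions force dF(e) = 1 (`AlgebraChart.hat_eq_one`),
which gives uniqueness. -/

noncomputable section

namespace NijenhuisF

/-! ### Linear algebra: cyclic vectors and operators commuting with a cyclic operator. -/

section LinearAlgebra

/-- If all eigenspaces of `f` are at most one-dimensional, then the kernel of `p(f)` has dimension
at most the degree of `p`. -/
lemma finrank_ker_aeval_le_natDegree {k V : Type*} [Field k] [AddCommGroup V] [Module k V]
    [FiniteDimensional k V] (f : Module.End k V)
    (hf : ∀ μ, Module.finrank k (f.eigenspace μ) ≤ 1) (s : Multiset k) :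
    Module.finrank k
      (LinearMap.ker (Polynomial.aeval f (s.map fun r => Polynomial.X - Polynomial.C r).prod))
      ≤ s.card := by
  induction s using Multiset.induction_on with
  | empty =>
    rw [Multiset.map_zero, Multiset.prod_zero, map_one, Module.End.one_eq_id, LinearMap.ker_id]
    simp
  | cons r s ih =>
    rw [Multiset.map_cons, Multiset.prod_cons, map_mul, Multiset.card_cons]
    set g := Polynomial.aeval f (s.map fun r => Polynomial.X - Polynomial.C r).prod
    have hr : Polynomial.aeval f (Polynomial.X - Polynomial.C r)
        = f - algebraMap k (Module.End k V) r := by simp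
    rw [hr]
    set h := f - algebraMap k (Module.End k V) r with hh
    have hk : Module.finrank k (LinearMap.ker h) ≤ 1 := by
      have := hf r
      rwa [Module.End.eigenspace_def] at this
    -- `g` maps ker(hg) into ker h, and the kernel of this map lies in ker g, so by rank–nullity
    -- each linear factor adds at most one dimension.
    let q : LinearMap.ker (h * g) →ₗ[k] LinearMap.ker h :=
      (g.domRestrict (LinearMap.ker (h * g))).codRestrict _ (fun x => by
        exact LinearMap.mem_ker.1 x.2)
    have h1 := LinearMap.finrank_range_add_finrank_ker q
    have h2 : Module.finrank k (LinearMap.range q) ≤ Module.finrank k (LinearMap.ker h) :=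
      Submodule.finrank_le _
    have h3 : Module.finrank k (LinearMap.ker q) ≤ Module.finrank k (LinearMap.ker g) := by
      let j : LinearMap.ker q →ₗ[k] LinearMap.ker g :=
        ((LinearMap.ker (h * g)).subtype.comp (LinearMap.ker q).subtype).codRestrict _ (fun x => by
          exact congrArg Subtype.val (LinearMap.mem_ker.1 x.2))
      refine LinearMap.finrank_le_finrank_of_injective (f := j) fun a b hab => ?_
      have := congrArg Subtype.val hab
      exact Subtype.ext (Subtype.ext this)
    omega

/-- If every eigenspace of the complexification of `f` is at most one-dimensional, no nonzero
polynomial of degree smaller than the dimension annihilates `f`. -/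
lemma finrank_le_natDegree_of_aeval_eq_zero {V : Type*} [AddCommGroup V] [Module ℝ V]
    [FiniteDimensional ℝ V] (f : Module.End ℝ V)
    (hf : ∀ μ : ℂ, Module.finrank ℂ (Module.End.eigenspace (f.baseChange ℂ) μ) ≤ 1)
    {p : Polynomial ℝ} (hp : p.Monic) (h0 : Polynomial.aeval f p = 0) :
    Module.finrank ℝ V ≤ p.natDegree := by
  have hb : Polynomial.aeval (f.baseChange ℂ) (p.map (algebraMap ℝ ℂ)) = 0 := by
    rw [Polynomial.aeval_map_algebraMap]
    have := Polynomial.aeval_algHom_apply (Module.End.baseChangeHom ℝ ℂ V) f p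
    rw [h0, map_zero] at this
    exact this
  have hs := IsAlgClosed.splits (p.map (algebraMap ℝ ℂ))
  have hm : (p.map (algebraMap ℝ ℂ)).Monic := hp.map _
  have := finrank_ker_aeval_le_natDegree (f.baseChange ℂ) hf (p.map (algebraMap ℝ ℂ)).roots
  rw [← hs.eq_prod_roots_of_monic hm, hb, LinearMap.ker_zero, finrank_top,
    ← hs.natDegree_eq_card_roots, Polynomial.natDegree_map, Module.finrank_baseChange] at this
  exact this

/-- An operator whose complexification has one-dimensional eigenspaces has a cyclic vector. -/
lemma exists_cyclic_vector {V : Type*} [AddCommGroup V] [Module ℝ V]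
    [FiniteDimensional ℝ V] (f : Module.End ℝ V)
    (hf : ∀ μ : ℂ, Module.finrank ℂ (Module.End.eigenspace (f.baseChange ℂ) μ) ≤ 1) :
    ∃ v : V, LinearIndependent ℝ (fun k : Fin (Module.finrank ℝ V) => (f ^ (k : ℕ)) v) := by
  have hm : minpoly ℝ f ≠ 0 := minpoly.ne_zero (Algebra.IsIntegral.isIntegral f)
  -- A real vector space is not a finite union of proper subspaces. The finitely many kernels of
  -- d(f) indexed here are proper by the degree bound, so some `v` avoids them all.
  let ι := {d : Polynomial ℝ // d.Monic ∧ d ∣ minpoly ℝ f ∧ d.natDegree < Module.finrank ℝ V}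
  have : Finite ι := by
    have := Polynomial.fintypeSubtypeMonicDvd (minpoly ℝ f) hm
    exact Finite.of_injective
      (fun d : ι => (⟨d.1, d.2.1, d.2.2.1⟩ :
        {g : Polynomial ℝ // g.Monic ∧ g ∣ minpoly ℝ f}))
      (fun a b h => Subtype.ext (congrArg (fun z => z.1) h))
  have hu : ⋃ d : ι, (LinearMap.ker (Polynomial.aeval f d.1) : Set V) ≠ Set.univ := by
    intro h
    obtain ⟨d, hd⟩ := Subspace.exists_eq_top_of_iUnion_eq_univ h
    have := finrank_le_natDegree_of_aeval_eq_zero f hf d.2.1 (LinearMap.ker_eq_top.1 hd)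
    exact absurd d.2.2.2 (by omega)
  obtain ⟨v, hv⟩ := (Set.ne_univ_iff_exists_notMem _).1 hu
  refine ⟨v, ?_⟩
  by_contra hli
  apply hv
  rw [Fintype.not_linearIndependent_iff] at hli
  obtain ⟨c, hc, i, hi⟩ := hli
  let p : Polynomial ℝ := ∑ k : Fin (Module.finrank ℝ V), Polynomial.monomial (k : ℕ) (c k)
  have hp0 : p ≠ 0 := by
    intro h
    have := congrArg (fun q => Polynomial.coeff q (i : ℕ)) h
    simp [p, Polynomial.coeff_monomial, Fin.val_inj] at this
    exact hi this
  have hpv : Polynomial.aeval f p v = 0 := by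
    rw [← hc]
    simp [p, Polynomial.aeval_monomial, LinearMap.sum_apply]
  have hpd : p.natDegree < Module.finrank ℝ V := by
    have hpos : 0 < Module.finrank ℝ V := i.pos
    have : p.natDegree ≤ Module.finrank ℝ V - 1 := by
      refine Polynomial.natDegree_sum_le_of_forall_le _ _ fun k _ => ?_
      exact (Polynomial.natDegree_monomial_le _).trans (by omega)
    omega
  -- By Bézout the gcd also kills `v`; after normalisation it is one of the divisors that `v` was
  -- chosen to avoid.
  let g := EuclideanDomain.gcd p (minpoly ℝ f)
  have hg0 : g ≠ 0 := fun h => hp0 (EuclideanDomain.gcd_eq_zero_iff.1 h).1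
  have hgv : Polynomial.aeval f g v = 0 := by
    have hg : g = EuclideanDomain.gcd p (minpoly ℝ f) := rfl
    rw [hg, EuclideanDomain.gcd_eq_gcd_ab, map_add, mul_comm p, mul_comm (minpoly ℝ f), map_mul,
      map_mul, minpoly.aeval]
    simp [hpv]
  have hgp : g ∣ p := EuclideanDomain.gcd_dvd_left _ _
  have hn : normalize g ∣ minpoly ℝ f :=
    normalize_dvd_iff.2 (EuclideanDomain.gcd_dvd_right _ _)
  refine Set.mem_iUnion.2 ⟨⟨normalize g, Polynomial.monic_normalize hg0, hn, ?_⟩, ?_⟩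
  · exact (Polynomial.natDegree_le_of_dvd (normalize_dvd_iff.2 hgp) hp0).trans_lt hpd
  · have : normalize g = (↑(normUnit g) : Polynomial ℝ) * g := by rw [normalize_apply, mul_comm]
    simp [this, hgv]

section Cyclic

variable {n : ℕ} {V : Type*} [AddCommGroup V] [Module ℝ V] [TopologicalSpace V]

/-- The basis formed by the iterates of a cyclic vector. -/
def cyclicBasis [FiniteDimensional ℝ V]
    (hn : Module.finrank ℝ V = n) {A : V →L[ℝ] V} {v : V}
    (hv : LinearIndependent ℝ fun k : Fin n => (A ^ (k : ℕ)) v) : Module.Basis (Fin n) ℝ V :=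
  basisOfLinearIndependentOfCardEqFinrank' _ hv (by simp [hn])

lemma cyclicBasis_apply [FiniteDimensional ℝ V]
    (hn : Module.finrank ℝ V = n) {A : V →L[ℝ] V} {v : V}
    (hv : LinearIndependent ℝ fun k : Fin n => (A ^ (k : ℕ)) v) (k : Fin n) :
    cyclicBasis hn hv k = (A ^ (k : ℕ)) v := by
  rw [cyclicBasis, coe_basisOfLinearIndependentOfCardEqFinrank']

lemma pow_apply_of_commute {A B : V →L[ℝ] V} (h : ∀ w, A (B w) = B (A w)) (k : ℕ) (w : V) :
    B ((A ^ k) w) = (A ^ k) (B w) := by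
  induction k generalizing w with
  | zero => simp
  | succ k ih => rw [pow_succ, mul_apply_eq_comp, mul_apply_eq_comp, ih, h]

/-- Operators commuting with `A` are determined by their value on a cyclic vector of `A`. -/
lemma ext_of_cyclic [FiniteDimensional ℝ V]
    (hn : Module.finrank ℝ V = n) {A B C : V →L[ℝ] V} {v : V}
    (hv : LinearIndependent ℝ fun k : Fin n => (A ^ (k : ℕ)) v)
    (hB : ∀ w, A (B w) = B (A w)) (hC : ∀ w, A (C w) = C (A w)) (h : B v = C v) : B = C := by
  apply ContinuousLinearMap.coe_injective
  refine (cyclicBasis hn hv).ext fun k => ?_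
  rw [cyclicBasis_apply]
  change B _ = C _
  rw [pow_apply_of_commute hB, pow_apply_of_commute hC, h]

lemma linearIndependent_rev_of_cyclic {A : V →L[ℝ] V} {v : V}
    (hv : LinearIndependent ℝ fun k : Fin n => (A ^ (k : ℕ)) v) :
    LinearIndependent ℝ fun i : Fin n => (A ^ (n - 1 - (i : ℕ))) v := by
  have := hv.comp Fin.rev Fin.rev_injective
  convert this using 3 with i
  simp only [Function.comp_apply, Fin.val_rev]
  congr 2
  omega

variable [IsTopologicalAddGroup V] [ContinuousSMul ℝ V]

lemma commute_sum_pow (A : V →L[ℝ] V) (c : Fin n → ℝ) (w : V) :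
    A ((∑ i : Fin n, c i • A ^ (n - 1 - (i : ℕ))) w)
      = (∑ i : Fin n, c i • A ^ (n - 1 - (i : ℕ))) (A w) := by
  simp only [sum_apply, map_sum, smul_apply, map_smul]
  refine Finset.sum_congr rfl fun i _ => ?_
  rw [pow_apply_of_commute (A := A) (B := A) fun _ => rfl]

/-- An operator commuting with `A` is a polynomial in `A`, if `A` has a cyclic vector. -/
lemma exists_eq_sum_pow [FiniteDimensional ℝ V]
    (hn : Module.finrank ℝ V = n) {A B : V →L[ℝ] V} {v : V}
    (hv : LinearIndependent ℝ fun k : Fin n => (A ^ (k : ℕ)) v)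
    (hB : ∀ w, A (B w) = B (A w)) :
    ∃ c : Fin n → ℝ, B = ∑ i : Fin n, c i • A ^ (n - 1 - (i : ℕ)) := by
  let b := basisOfLinearIndependentOfCardEqFinrank' _ (linearIndependent_rev_of_cyclic hv)
    (by simp [hn])
  refine ⟨fun i => b.repr (B v) i, ext_of_cyclic hn hv hB (commute_sum_pow A _) ?_⟩
  conv_lhs => rw [← b.sum_repr (B v)]
  simp [b, sum_apply, -FunLike.coe_pow]

lemma sum_pow_injective {A : V →L[ℝ] V} {v : V}
    (hv : LinearIndependent ℝ fun k : Fin n => (A ^ (k : ℕ)) v) {c c' : Fin n → ℝ}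
    (h : (∑ i : Fin n, c i • A ^ (n - 1 - (i : ℕ))) v
      = (∑ i : Fin n, c' i • A ^ (n - 1 - (i : ℕ))) v) : c = c' := by
  have hl := linearIndependent_rev_of_cyclic hv
  rw [Fintype.linearIndependent_iff] at hl
  funext i
  refine sub_eq_zero.1 (hl (fun i => c i - c' i) ?_ i)
  simp only [sum_apply, smul_apply] at h
  simp only [sub_smul, Finset.sum_sub_distrib, h, sub_self]

/-- If `T` is linear over `A` in the second argument, and linear over `A` in the first argument on
the diagonal, then it is linear over `A` in the first argument. -/
lemma bilin_linear_left_of_diag [FiniteDimensional ℝ V]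
    (hn : Module.finrank ℝ V = n) {A : V →L[ℝ] V} {v : V}
    (hv : LinearIndependent ℝ fun k : Fin n => (A ^ (k : ℕ)) v) (T : V →L[ℝ] V →L[ℝ] V)
    (hr : ∀ u w, T u (A w) = A (T u w)) (hd : ∀ u, A (T u u) = T (A u) u) (u w : V) :
    T (A u) w = A (T u w) := by
  -- The defect `S` is alternating and A-linear in its second argument, hence S(A^i v, A^j v) =
  -- -A^(i+j) S(v, v) = 0.
  let S : V →ₗ[ℝ] V →ₗ[ℝ] V := LinearMap.mk₂ ℝ (fun u w => T (A u) w - A (T u w))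
    (by intros; simp; abel) (by intros; simp [smul_sub]) (by intros; simp; abel)
    (by intros; simp [smul_sub])
  have hS : ∀ u w, S u w = T (A u) w - A (T u w) := fun u w => rfl
  have hself : ∀ u, S u u = 0 := fun u => by rw [hS, hd, sub_self]
  have hanti : ∀ u w, S u w = - S w u := fun u w => by
    have := hself (u + w)
    simp only [map_add, LinearMap.add_apply, hself, zero_add, add_zero] at this
    exact eq_neg_of_add_eq_zero_right this
  have hpow : ∀ u (k : ℕ) w, S u ((A ^ k) w) = (A ^ k) (S u w) := fun u k w => by
    rw [hS, hS, pow_apply_of_commute (fun w => (hr (A u) w).symm),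
      pow_apply_of_commute (fun w => (hr u w).symm), map_sub,
      pow_apply_of_commute (A := A) (B := A) fun _ => rfl]
  have h0 : S = 0 := by
    refine (cyclicBasis hn hv).ext fun i => (cyclicBasis hn hv).ext fun j => ?_
    rw [cyclicBasis_apply, cyclicBasis_apply, hpow, hanti, hpow, hself]
    simp
  have := hS u w
  rw [h0] at this
  exact sub_eq_zero.1 this.symm

end Cyclic

end LinearAlgebra

/-! ### Calculus of vector-valued functions, brackets and pulled-back constant fields. -/

section Calculus

open Filter Topology VectorField

variable {n : ℕ} {X : Type*} [TopologicalSpace X] [ChartedSpace (Model n) X]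
  {B : Type*} [NormedAddCommGroup B] [NormedSpace ℝ B]

lemma two_le_infty : (2 : ℕ∞ω) ≤ ∞ :=
  WithTop.coe_le_coe.2 (le_top : (2 : ℕ∞) ≤ ⊤)

lemma mvfderiv_apply_eq_mfderiv (f : X → B) (x : X) (v : Tan n x) :
    mvfderiv 𝓘(ℝ, Model n) f x v = mfderiv 𝓘(ℝ, Model n) 𝓘(ℝ, B) f x v := rfl

lemma _root_.Filter.EventuallyEq.mvfderiv_apply_eq {f g : X → B} {x : X} (h : f =ᶠ[𝓝 x] g)
    (v : Tan n x) :
    mvfderiv 𝓘(ℝ, Model n) f x v = mvfderiv 𝓘(ℝ, Model n) g x v := by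
  rw [mvfderiv_apply_eq_mfderiv, mvfderiv_apply_eq_mfderiv, h.mfderiv_eq]
  rfl

lemma mvfderiv_clm_comp {B' : Type*} [NormedAddCommGroup B'] [NormedSpace ℝ B']
    (l : B →L[ℝ] B') {f : X → B} {x : X} (hf : MDifferentiableAt 𝓘(ℝ, Model n) 𝓘(ℝ, B) f x)
    (v : Tan n x) :
    mvfderiv 𝓘(ℝ, Model n) (fun y => l (f y)) x v = l (mvfderiv 𝓘(ℝ, Model n) f x v) := by
  have h := mfderiv_comp_apply (I := 𝓘(ℝ, Model n)) (I' := 𝓘(ℝ, B)) (I'' := 𝓘(ℝ, B')) x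
    (g := l) (f := f) l.mdifferentiableAt hf v
  rw [mvfderiv_apply_eq_mfderiv, mvfderiv_apply_eq_mfderiv]
  refine h.trans ?_
  rw [ContinuousLinearMap.mfderiv_eq]
  rfl

lemma mvfderiv_finset_sum {ι : Type*} (s : Finset ι) {f : ι → X → B} {x : X}
    (h : ∀ i, MDifferentiableAt 𝓘(ℝ, Model n) 𝓘(ℝ, B) (f i) x) (v : Tan n x) :
    mvfderiv 𝓘(ℝ, Model n) (fun y => ∑ i ∈ s, f i y) x v
      = ∑ i ∈ s, mvfderiv 𝓘(ℝ, Model n) (f i) x v := by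
  classical
  suffices MDifferentiableAt 𝓘(ℝ, Model n) 𝓘(ℝ, B) (fun y => ∑ i ∈ s, f i y) x ∧
      mvfderiv 𝓘(ℝ, Model n) (fun y => ∑ i ∈ s, f i y) x v
        = ∑ i ∈ s, mvfderiv 𝓘(ℝ, Model n) (f i) x v from this.2
  induction s using Finset.induction_on with
  | empty =>
    simp only [Finset.sum_empty, mvfderiv_const]
    exact ⟨mdifferentiableAt_const, rfl⟩
  | insert i s hi ih =>
    simp only [Finset.sum_insert hi]
    refine ⟨(h i).add ih.1, ?_⟩
    rw [mvfderiv_fun_add (h i) ih.1, add_apply, ih.2]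

lemma mvfderiv_ring_mul {R : Type*} [NormedCommRing R] [NormedAlgebra ℝ R] {f g : X → R} {x : X}
    (hf : MDifferentiableAt 𝓘(ℝ, Model n) 𝓘(ℝ, R) f x)
    (hg : MDifferentiableAt 𝓘(ℝ, Model n) 𝓘(ℝ, R) g x) (v : Tan n x) :
    mvfderiv 𝓘(ℝ, Model n) (fun y => f y * g y) x v
      = f x * mvfderiv 𝓘(ℝ, Model n) g x v + g x * mvfderiv 𝓘(ℝ, Model n) f x v := by
  have h : HasMFDerivAt 𝓘(ℝ, Model n) 𝓘(ℝ, R) (f * g) x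
      (f x • mvfderiv 𝓘(ℝ, Model n) g x + g x • mvfderiv 𝓘(ℝ, Model n) f x : Tan n x →L[ℝ] R) :=
    HasMFDerivAt.mul hf.hasMFDerivAt hg.hasMFDerivAt
  rw [mvfderiv_apply_eq_mfderiv, show (fun y => f y * g y) = f * g from rfl, h.mfderiv]
  rfl

lemma mdifferentiableAt_of_contMDiffOn {U : Set X} (hU : IsOpen U) {f : X → B}
    (hf : ContMDiffOn 𝓘(ℝ, Model n) 𝓘(ℝ, B) ∞ f U) {x : X} (hx : x ∈ U) :
    MDifferentiableAt 𝓘(ℝ, Model n) 𝓘(ℝ, B) f x :=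
  (hf.contMDiffAt (hU.mem_nhds hx)).mdifferentiableAt (by simp)

/-- A chart of the maximal atlas has bijective derivative. -/
lemma mvfderiv_chart_bijective {φ : OpenPartialHomeomorph X (Model n)}
    (hφ : φ ∈ IsManifold.maximalAtlas 𝓘(ℝ, Model n) ∞ X) {x : X} (hx : x ∈ φ.source) :
    Function.Bijective (mvfderiv 𝓘(ℝ, Model n) φ x) := by
  have : OpenPartialHomeomorph.MDifferentiable 𝓘(ℝ, Model n) 𝓘(ℝ, Model n) φ :=
    ⟨(contMDiffOn_of_mem_maximalAtlas hφ).mdifferentiableOn (by simp),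
      (contMDiffOn_symm_of_mem_maximalAtlas hφ).mdifferentiableOn (by simp)⟩
  exact this.mfderiv_bijective hx

lemma isInvertible_mfderiv_of_bijective {f : X → B} {x : X}
    (h : Function.Bijective (mvfderiv 𝓘(ℝ, Model n) f x)) :
    (mfderiv 𝓘(ℝ, Model n) 𝓘(ℝ, B) f x).IsInvertible := by
  let l : Model n →L[ℝ] B := mvfderiv 𝓘(ℝ, Model n) f x
  exact ⟨(LinearEquiv.ofBijective (l : Model n →ₗ[ℝ] B) h).toContinuousLinearEquiv, by ext; rfl⟩

/-- The pullback uses `ContinuousLinearMap.inverse`, which is meaningful only for an invertible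
derivative; bijectivity guarantees this. -/
lemma mvfderiv_mpullback_const {f : X → B} {x : X}
    (hb : Function.Bijective (mvfderiv 𝓘(ℝ, Model n) f x)) (c : B) :
    mvfderiv 𝓘(ℝ, Model n) f x (mpullback 𝓘(ℝ, Model n) 𝓘(ℝ, B) f (fun _ => c) x) = c := by
  obtain ⟨M, hM⟩ := isInvertible_mfderiv_of_bijective hb
  change mfderiv 𝓘(ℝ, Model n) 𝓘(ℝ, B) f x ((mfderiv 𝓘(ℝ, Model n) 𝓘(ℝ, B) f x).inverse c) = c
  rw [← hM, ContinuousLinearMap.inverse_equiv]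
  exact M.apply_symm_apply c

variable [IsManifold 𝓘(ℝ, Model n) ∞ X]

/-- The derivative of a smooth function along a smooth vector field is smooth. -/
lemma contMDiffOn_mvfderiv_apply {U : Set X} (hU : IsOpen U) {f : X → B}
    (hf : ContMDiffOn 𝓘(ℝ, Model n) 𝓘(ℝ, B) ∞ f U) {V : VField n X} (hV : SmoothVFieldOn V U) :
    ContMDiffOn 𝓘(ℝ, Model n) 𝓘(ℝ, B) ∞ (fun y => mvfderiv 𝓘(ℝ, Model n) f y (V y)) U := by
  have : IsManifold 𝓘(ℝ, Model n) 1 X := IsManifold.of_le (n := ∞) (by simp)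
  have h1 := hf.contMDiffOn_tangentMapWithin (m := ∞) (by simp) hU.uniqueMDiffOn
  have h2 := h1.comp hV (fun y hy => hy)
  have h3 := (contMDiff_snd_tangentBundle_modelSpace (n := ∞) B 𝓘(ℝ, B)).comp_contMDiffOn h2
  refine h3.congr fun y hy => ?_
  change mfderiv 𝓘(ℝ, Model n) 𝓘(ℝ, B) f y (V y)
    = mfderivWithin 𝓘(ℝ, Model n) 𝓘(ℝ, B) f U y (V y)
  rw [mfderivWithin_of_isOpen hU hy]

/-- Pulling back by the inverse chart preserves the action of fields on functions, which reduces the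
bracket formula to the model space. -/
lemma fderiv_comp_extChartAt_symm_mpullback (x : X) {y : Model n}
    (hy : y ∈ (extChartAt 𝓘(ℝ, Model n) x).target) {h : X → B}
    (hh : MDifferentiableAt 𝓘(ℝ, Model n) 𝓘(ℝ, B) h ((extChartAt 𝓘(ℝ, Model n) x).symm y))
    (V : VField n X) :
    fderiv ℝ (h ∘ (extChartAt 𝓘(ℝ, Model n) x).symm) y
      (mpullback 𝓘(ℝ, Model n) 𝓘(ℝ, Model n) (extChartAt 𝓘(ℝ, Model n) x).symm V y)
      = mvfderiv 𝓘(ℝ, Model n) h ((extChartAt 𝓘(ℝ, Model n) x).symm y)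
          (V ((extChartAt 𝓘(ℝ, Model n) x).symm y)) := by
  have : IsManifold 𝓘(ℝ, Model n) 1 X := IsManifold.of_le (n := ∞) (by simp)
  have hinv := isInvertible_mfderivWithin_extChartAt_symm hy
  rw [ModelWithCorners.range_eq_univ, mfderivWithin_univ] at hinv
  have hd := mdifferentiableAt_of_isInvertible_mfderiv hinv
  rw [← mfderiv_eq_fderiv]
  refine (mfderiv_comp_apply (I' := 𝓘(ℝ, Model n)) y hh hd _).trans ?_
  rw [mpullback_apply]
  obtain ⟨M, hM⟩ := hinv
  rw [← hM, ContinuousLinearMap.inverse_equiv]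
  exact congrArg (mvfderiv 𝓘(ℝ, Model n) h _) (M.apply_symm_apply _)

/-- The vector field `[V, W]` acts on functions as the commutator of the derivations `V`, `W`. -/
lemma mvfderiv_bracket {U : Set X} (hU : IsOpen U) {f : X → B}
    (hf : ContMDiffOn 𝓘(ℝ, Model n) 𝓘(ℝ, B) ∞ f U) {V W : VField n X}
    (hV : SmoothVFieldOn V U) (hW : SmoothVFieldOn W U) {x : X} (hx : x ∈ U) :
    mvfderiv 𝓘(ℝ, Model n) f x (bracket V W x)
      = mvfderiv 𝓘(ℝ, Model n) (fun y => mvfderiv 𝓘(ℝ, Model n) f y (W y)) x (V x)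
        - mvfderiv 𝓘(ℝ, Model n) (fun y => mvfderiv 𝓘(ℝ, Model n) f y (V y)) x (W x) := by
  have : IsManifold 𝓘(ℝ, Model n) 1 X := IsManifold.of_le (n := ∞) (by simp)
  have : IsManifold 𝓘(ℝ, Model n) (minSmoothness ℝ 2) X := by
    rw [minSmoothness_of_isRCLikeNormedField]
    exact IsManifold.of_le (n := ∞) two_le_infty
  set ψ := extChartAt 𝓘(ℝ, Model n) x with hψ
  set y₀ := ψ x with hy₀
  have hy₀t : y₀ ∈ ψ.target := mem_extChartAt_target x
  have ht : ψ.target ∈ 𝓝 y₀ := extChartAt_target_mem_nhds x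
  have hσy : ψ.symm y₀ = x := extChartAt_to_inv x
  have hinv := isInvertible_mfderivWithin_extChartAt_symm (I := 𝓘(ℝ, Model n)) hy₀t
  rw [ModelWithCorners.range_eq_univ, mfderivWithin_univ] at hinv
  have hσ : ContMDiffAt 𝓘(ℝ, Model n) 𝓘(ℝ, Model n) ∞ ψ.symm y₀ :=
    (contMDiffOn_extChartAt_symm x).contMDiffAt ht
  have hUn : U ∈ 𝓝 (ψ.symm y₀) := by rw [hσy]; exact hU.mem_nhds hx
  have hev : ∀ᶠ y in 𝓝 y₀, y ∈ ψ.target ∧ ψ.symm y ∈ U :=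
    Filter.Eventually.and ht (hσ.continuousAt.preimage_mem_nhds hUn)
  set V' := mpullback 𝓘(ℝ, Model n) 𝓘(ℝ, Model n) ψ.symm V with hV'
  set W' := mpullback 𝓘(ℝ, Model n) 𝓘(ℝ, Model n) ψ.symm W with hW'
  have hsm : ∀ Z : VField n X, SmoothVFieldOn Z U →
      ContDiffAt ℝ ∞ (mpullback 𝓘(ℝ, Model n) 𝓘(ℝ, Model n) ψ.symm Z : Model n → Model n) y₀ := by
    intro Z hZ
    have := ContMDiffAt.mpullback_vectorField_preimage (m := ∞) (hZ.contMDiffAt hUn) hσ hinv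
      (by simp)
    exact contMDiffAt_vectorSpace_iff_contDiffAt.1 this
  have hfσ : ContDiffAt ℝ ∞ (f ∘ ψ.symm) y₀ :=
    ((hf.contMDiffAt hUn).comp y₀ hσ).contDiffAt
  -- In the chart Y(Zf) = Df(DZ·Y) + D²f(Y,Z). The second term cancels in the commutator by symmetry
  -- of D²f, leaving Df applied to the bracket.
  have key : ∀ Z Y : VField n X, SmoothVFieldOn Z U → SmoothVFieldOn Y U →
      mvfderiv 𝓘(ℝ, Model n) (fun y => mvfderiv 𝓘(ℝ, Model n) f y (Z y)) x (Y x)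
        = fderiv ℝ (f ∘ ψ.symm) y₀ (fderiv ℝ
            (mpullback 𝓘(ℝ, Model n) 𝓘(ℝ, Model n) ψ.symm Z : Model n → Model n) y₀
            (mpullback 𝓘(ℝ, Model n) 𝓘(ℝ, Model n) ψ.symm Y y₀))
          + fderiv ℝ (fderiv ℝ (f ∘ ψ.symm)) y₀
              (mpullback 𝓘(ℝ, Model n) 𝓘(ℝ, Model n) ψ.symm Y y₀)
              (mpullback 𝓘(ℝ, Model n) 𝓘(ℝ, Model n) ψ.symm Z y₀) := by
    intro Z Y hZ hY
    have hd := mdifferentiableAt_of_contMDiffOn hU (contMDiffOn_mvfderiv_apply hU hf hZ)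
      (x := ψ.symm y₀) (by rw [hσy]; exact hx)
    have h1 := fderiv_comp_extChartAt_symm_mpullback x hy₀t hd Y
    rw [← hψ, hσy] at h1
    rw [← h1]
    have h2 : (fun y => mvfderiv 𝓘(ℝ, Model n) f y (Z y)) ∘ ψ.symm =ᶠ[𝓝 y₀]
        fun y => fderiv ℝ (f ∘ ψ.symm) y
          (mpullback 𝓘(ℝ, Model n) 𝓘(ℝ, Model n) ψ.symm Z y) := by
      filter_upwards [hev] with y hy
      exact (fderiv_comp_extChartAt_symm_mpullback x hy.1
        (mdifferentiableAt_of_contMDiffOn hU hf hy.2) Z).symm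
    rw [h2.fderiv_eq]
    have hd1 : DifferentiableAt ℝ (fderiv ℝ (f ∘ ψ.symm)) y₀ :=
      (hfσ.fderiv_right (m := 1) (one_add_one_eq_two.trans_le two_le_infty)).differentiableAt
        (by simp)
    have hd2 := (hsm Z hZ).differentiableAt (by simp)
    erw [fderiv_clm_apply hd1 hd2]
    rfl
  have hb : mvfderiv 𝓘(ℝ, Model n) f x (bracket V W x)
      = fderiv ℝ (f ∘ ψ.symm) y₀ (lieBracket ℝ V' W' y₀) := by
    have h1 := fderiv_comp_extChartAt_symm_mpullback x hy₀t
      (mdifferentiableAt_of_contMDiffOn hU hf (x := ψ.symm y₀) (by rw [hσy]; exact hx))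
      (bracket V W)
    rw [← hψ, hσy] at h1
    rw [← h1, mpullback_mlieBracket (n := ∞)
      ((hV.contMDiffAt hUn).mdifferentiableAt (by simp))
      ((hW.contMDiffAt hUn).mdifferentiableAt (by simp)) hσ
      (by rw [minSmoothness_of_isRCLikeNormedField]; exact two_le_infty),
      ← mlieBracketWithin_univ, mlieBracketWithin_eq_lieBracketWithin]
    exact congrArg (fun Z : Model n → Model n => fderiv ℝ (f ∘ ψ.symm) y₀ (Z y₀))
      (lieBracketWithin_univ (V := V') (W := W'))
  have hs : IsSymmSndFDerivAt ℝ (f ∘ ψ.symm) y₀ :=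
    hfσ.isSymmSndFDerivAt (by rw [minSmoothness_of_isRCLikeNormedField]; exact two_le_infty)
  rw [hb, key W V hW hV, key V W hV hW, hs (W' y₀) (V' y₀)]
  simp only [lieBracket, map_sub]
  abel

/-- Pullbacks of constant vector fields by maps with bijective derivative are smooth. -/
lemma smoothVFieldOn_mpullback_const {U : Set X} (hU : IsOpen U) {f : X → B}
    (hf : ContMDiffOn 𝓘(ℝ, Model n) 𝓘(ℝ, B) ∞ f U)
    (hb : ∀ x ∈ U, Function.Bijective (mvfderiv 𝓘(ℝ, Model n) f x)) (c : B) :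
    SmoothVFieldOn (n := n) (mpullback 𝓘(ℝ, Model n) 𝓘(ℝ, B) f (fun _ => c)) U := by
  have : IsManifold 𝓘(ℝ, Model n) 1 X := IsManifold.of_le (n := ∞) (by simp)
  intro x hx
  have hc : ContMDiffAt 𝓘(ℝ, B) 𝓘(ℝ, B).tangent ∞
      (fun y => (⟨y, c⟩ : TangentBundle 𝓘(ℝ, B) B)) (f x) :=
    contMDiffAt_vectorSpace_iff_contDiffAt.2 contDiffAt_const
  exact (ContMDiffAt.mpullback_vectorField_preimage hc (hf.contMDiffAt (hU.mem_nhds hx))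
    (isInvertible_mfderiv_of_bijective (hb x hx)) (by simp)).contMDiffWithinAt

end Calculus

/-! ### Coordinates with values in a commutative algebra, and the identities read off in them. -/

section AlgebraChart

open Filter Topology VectorField

variable {n : ℕ} {X : Type*} [TopologicalSpace X] [ChartedSpace (Model n) X]
  {R : Type*} [NormedCommRing R] [NormedAlgebra ℝ R]

/-- The element `g_0 a ^ (n - 1) + ⋯ + g_{n-1}` of the algebra `R`, where the `g_i` are the
coefficients of `M` with respect to `L`. -/
def symbol (L M : OpField n X) (a : R) (x : X) : R :=
  ∑ i : Fin n, coeff L M i x • a ^ (n - 1 - (i : ℕ))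

/-- The map `symbol L M a` is a local diffeomorphism on `U` that takes `L` to the multiplication
by `a`. -/
structure AlgebraChart [IsManifold 𝓘(ℝ, Model n) ∞ X]
    (L M : OpField n X) (a : R) (U : Set X) : Prop where
  isOpen : IsOpen U
  smooth_L : SmoothOpField L
  smooth_M : SmoothOpField M
  expansion : ∀ x, IsExpansionAt L M x fun i => coeff L M i x
  smooth_coeff : ∀ i, ContMDiffOn 𝓘(ℝ, Model n) 𝓘(ℝ, ℝ) ∞ (coeff L M i) U
  bijective : ∀ x ∈ U, Function.Bijective (mvfderiv 𝓘(ℝ, Model n) (symbol L M a) x)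
  map_L : ∀ x ∈ U, ∀ v : Tan n x, mvfderiv 𝓘(ℝ, Model n) (symbol L M a) x (L x v)
    = a * mvfderiv 𝓘(ℝ, Model n) (symbol L M a) x v
  linearIndependent : LinearIndependent ℝ fun k : Fin n => a ^ (k : ℕ)

lemma contMDiffOn_symbol {L M : OpField n X} {a : R} {U : Set X}
    (h : ∀ i, ContMDiffOn 𝓘(ℝ, Model n) 𝓘(ℝ, ℝ) ∞ (coeff L M i) U) :
    ContMDiffOn 𝓘(ℝ, Model n) 𝓘(ℝ, R) ∞ (symbol L M a) U :=
  contMDiffOn_finsetSum fun i _ => (h i).smul contMDiffOn_const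

lemma mvfderiv_symbol {L M : OpField n X} {a : R} {x : X}
    (h : ∀ i, MDifferentiableAt 𝓘(ℝ, Model n) 𝓘(ℝ, ℝ) (coeff L M i) x) (v : Tan n x) :
    mvfderiv 𝓘(ℝ, Model n) (symbol L M a) x v
      = ∑ i : Fin n, differential (n := n) (coeff L M i) x v • a ^ (n - 1 - (i : ℕ)) := by
  let l (i : Fin n) : ℝ →L[ℝ] R :=
    (ContinuousLinearMap.id ℝ ℝ).smulRight (a ^ (n - 1 - (i : ℕ)))
  refine (mvfderiv_finset_sum Finset.univ (f := fun i y => l i (coeff L M i y)) (fun i =>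
    (l i).mdifferentiableAt.comp (I' := 𝓘(ℝ, ℝ)) x (h i)) v).trans ?_
  exact Finset.sum_congr rfl fun i _ => mvfderiv_clm_comp (l i) (h i) v

lemma map_sum_pow {V : Type*} [AddCommGroup V] [Module ℝ V] [TopologicalSpace V]
    [IsTopologicalAddGroup V] [ContinuousSMul ℝ V] {a : R} {A : V →L[ℝ] V} {D : V →L[ℝ] R}
    (h : ∀ v, D (A v) = a * D v) (c : Fin n → ℝ) (v : V) :
    D ((∑ i : Fin n, c i • A ^ (n - 1 - (i : ℕ))) v)
      = (∑ i : Fin n, c i • a ^ (n - 1 - (i : ℕ))) * D v := by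
  have hp : ∀ (k : ℕ) v, D ((A ^ k) v) = a ^ k * D v := by
    intro k
    induction k with
    | zero => simp
    | succ k ih => intro v; rw [pow_succ, mul_apply_eq_comp, ih, h, pow_succ, mul_assoc]
  simp only [sum_apply, smul_apply, map_sum, map_smul, hp, Finset.sum_mul, smul_mul_assoc]

variable [IsManifold 𝓘(ℝ, Model n) ∞ X]

lemma SmoothOpField.app {A : OpField n X} (hA : SmoothOpField A) {V : VField n X} {U : Set X}
    (hV : SmoothVFieldOn V U) : SmoothVFieldOn (app A V) U := by
  have : IsManifold 𝓘(ℝ, Model n) 1 X := IsManifold.of_le (n := ∞) (by simp)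
  have : IsManifold 𝓘(ℝ, Model n) (∞ + 1) X := by simpa
  exact ContMDiffOn.clm_bundle_apply (F₁ := Model n) (F₂ := Model n) hA.contMDiffOn hV

lemma SmoothOpField.app_pow {A : OpField n X} (hA : SmoothOpField A) {V : VField n X} {U : Set X}
    (hV : SmoothVFieldOn V U) (k : ℕ) : SmoothVFieldOn (fun x => ((A x) ^ k) (V x)) U := by
  induction k with
  | zero => exact hV
  | succ k ih =>
    have := hA.app ih
    simp only [pow_succ']
    exact this

lemma smoothVFieldOn_symmetryTensor {L M : OpField n X} (hL : SmoothOpField L) {U : Set X}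
    (hU : IsOpen U)
    (hc : ∀ i, ContMDiffOn 𝓘(ℝ, Model n) 𝓘(ℝ, ℝ) ∞ (coeff L M i) U) {V W : VField n X}
    (hV : SmoothVFieldOn V U) (hW : SmoothVFieldOn W U) :
    SmoothVFieldOn (prod (symmetryTensor L M) V W) U := by
  have : IsManifold 𝓘(ℝ, Model n) 1 X := IsManifold.of_le (n := ∞) (by simp)
  have : IsManifold 𝓘(ℝ, Model n) (∞ + 1) X := by simpa
  have h : SmoothVFieldOn (n := n) (fun x => ∑ i : Fin n,
      (mvfderiv 𝓘(ℝ, Model n) (coeff L M i) x (V x)) • ((L x) ^ (n - 1 - (i : ℕ))) (W x)) U :=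
    ContMDiffOn.sum_section fun i _ =>
      (contMDiffOn_mvfderiv_apply hU (hc i) hV).smul_section (hL.app_pow hW _)
  convert h using 2 with x
  simp only [prod, symmetryTensor, sum_apply]
  rfl

namespace AlgebraChart

variable {L M : OpField n X} {a : R} {U : Set X}

lemma mono (S : AlgebraChart L M a U) {U' : Set X} (h : IsOpen U') (hU : U' ⊆ U) :
    AlgebraChart L M a U' where
  isOpen := h
  smooth_L := S.smooth_L
  smooth_M := S.smooth_M
  expansion := S.expansion
  smooth_coeff i := (S.smooth_coeff i).mono hU
  bijective x hx := S.bijective x (hU hx)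
  map_L x hx := S.map_L x (hU hx)
  linearIndependent := S.linearIndependent

lemma smooth_symbol (S : AlgebraChart L M a U) :
    ContMDiffOn 𝓘(ℝ, Model n) 𝓘(ℝ, R) ∞ (symbol L M a) U :=
  contMDiffOn_symbol S.smooth_coeff

lemma smooth_prod (S : AlgebraChart L M a U) {V W : VField n X}
    (hV : SmoothVFieldOn V U) (hW : SmoothVFieldOn W U) :
    SmoothVFieldOn (prod (symmetryTensor L M) V W) U :=
  smoothVFieldOn_symmetryTensor S.smooth_L S.isOpen S.smooth_coeff hV hW

/-- `M` is the polynomial in `L` whose value at a is the symbol. The map `D` is kept arbitrary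
because `hat_eq_one` needs it for the derivative of `hat L M a e`, not only for that of the symbol.
-/
lemma map_op (S : AlgebraChart L M a U) {x : X} {D : Tan n x →L[ℝ] R}
    (h : ∀ v, D (L x v) = a * D v) (v : Tan n x) :
    D (M x v) = symbol L M a x * D v := by
  rw [show M x = _ from S.expansion x, map_sum_pow h]
  rfl

lemma map_M (S : AlgebraChart L M a U) {x : X} (hx : x ∈ U) (v : Tan n x) :
    mvfderiv 𝓘(ℝ, Model n) (symbol L M a) x (M x v)
      = symbol L M a x * mvfderiv 𝓘(ℝ, Model n) (symbol L M a) x v :=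
  S.map_op (S.map_L x hx) v

/-- T_M(u,·) is the polynomial in `L` with coefficients dg_i(u); the same polynomial in a is dF(u).
-/
lemma map_mul (S : AlgebraChart L M a U) {x : X} (hx : x ∈ U) (u v : Tan n x) :
    mvfderiv 𝓘(ℝ, Model n) (symbol L M a) x (symmetryTensor L M x u v)
      = mvfderiv 𝓘(ℝ, Model n) (symbol L M a) x u
        * mvfderiv 𝓘(ℝ, Model n) (symbol L M a) x v := by
  rw [mvfderiv_symbol (fun i => mdifferentiableAt_of_contMDiffOn S.isOpen (S.smooth_coeff i) hx) u,
    ← map_sum_pow (S.map_L x hx)]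
  simp only [symmetryTensor, sum_apply]
  rfl

lemma inj (S : AlgebraChart L M a U) {x : X} (hx : x ∈ U) {u v : Tan n x}
    (h : mvfderiv 𝓘(ℝ, Model n) (symbol L M a) x u = mvfderiv 𝓘(ℝ, Model n) (symbol L M a) x v) :
    u = v :=
  (S.bijective x hx).1 h

/-- The function `V (symbol L M a)` associated with a vector field `V`. -/
abbrev _root_.NijenhuisF.hat (L M : OpField n X) (a : R) (V : VField n X) (y : X) : R :=
  mvfderiv 𝓘(ℝ, Model n) (symbol L M a) y (V y)

lemma mdifferentiableAt_hat (S : AlgebraChart L M a U) {V : VField n X}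
    (hV : SmoothVFieldOn V U) {x : X} (hx : x ∈ U) :
    MDifferentiableAt 𝓘(ℝ, Model n) 𝓘(ℝ, R) (hat L M a V) x :=
  mdifferentiableAt_of_contMDiffOn S.isOpen
    (contMDiffOn_mvfderiv_apply S.isOpen S.smooth_symbol hV) hx

lemma map_bracket (S : AlgebraChart L M a U) {V W : VField n X}
    (hV : SmoothVFieldOn V U) (hW : SmoothVFieldOn W U) {x : X} (hx : x ∈ U) :
    mvfderiv 𝓘(ℝ, Model n) (symbol L M a) x (bracket V W x)
      = mvfderiv 𝓘(ℝ, Model n) (hat L M a W) x (V x)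
        - mvfderiv 𝓘(ℝ, Model n) (hat L M a V) x (W x) :=
  mvfderiv_bracket S.isOpen S.smooth_symbol hV hW hx

lemma mvfderiv_hat_L (S : AlgebraChart L M a U) {V : VField n X}
    (hV : SmoothVFieldOn V U) {x : X} (hx : x ∈ U) (v : Tan n x) :
    mvfderiv 𝓘(ℝ, Model n) (hat L M a (app L V)) x v
      = a * mvfderiv 𝓘(ℝ, Model n) (hat L M a V) x v := by
  have h : hat L M a (app L V) =ᶠ[𝓝 x] fun y => a * hat L M a V y := by
    filter_upwards [S.isOpen.mem_nhds hx] with y hy using S.map_L y hy _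
  rw [h.mvfderiv_apply_eq, mvfderiv_ring_mul mdifferentiableAt_const
    (S.mdifferentiableAt_hat hV hx), mvfderiv_const]
  simp

/-- Unlike a, the multiplier F varies from point to point. The resulting second Leibniz term is the
source of 𝓛_e M = Id and of the Euler identity. -/
lemma mvfderiv_hat_M (S : AlgebraChart L M a U) {V : VField n X}
    (hV : SmoothVFieldOn V U) {x : X} (hx : x ∈ U) (v : Tan n x) :
    mvfderiv 𝓘(ℝ, Model n) (hat L M a (app M V)) x v
      = symbol L M a x * mvfderiv 𝓘(ℝ, Model n) (hat L M a V) x v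
        + hat L M a V x * mvfderiv 𝓘(ℝ, Model n) (symbol L M a) x v := by
  have h : hat L M a (app M V) =ᶠ[𝓝 x] fun y => symbol L M a y * hat L M a V y := by
    filter_upwards [S.isOpen.mem_nhds hx] with y hy using S.map_M hy _
  rw [h.mvfderiv_apply_eq, mvfderiv_ring_mul
    (mdifferentiableAt_of_contMDiffOn S.isOpen S.smooth_symbol hx) (S.mdifferentiableAt_hat hV hx)]

lemma mvfderiv_hat_prod (S : AlgebraChart L M a U) {V W : VField n X}
    (hV : SmoothVFieldOn V U) (hW : SmoothVFieldOn W U) {x : X} (hx : x ∈ U) (v : Tan n x) :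
    mvfderiv 𝓘(ℝ, Model n) (hat L M a (prod (symmetryTensor L M) V W)) x v
      = hat L M a V x * mvfderiv 𝓘(ℝ, Model n) (hat L M a W) x v
        + hat L M a W x * mvfderiv 𝓘(ℝ, Model n) (hat L M a V) x v := by
  have h : hat L M a (prod (symmetryTensor L M) V W) =ᶠ[𝓝 x]
      fun y => hat L M a V y * hat L M a W y := by
    filter_upwards [S.isOpen.mem_nhds hx] with y hy using S.map_mul hy _ _
  rw [h.mvfderiv_apply_eq, mvfderiv_ring_mul (S.mdifferentiableAt_hat hV hx)
    (S.mdifferentiableAt_hat hW hx)]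

lemma mvfderiv_hat_unity (S : AlgebraChart L M a U) {e : VField n X}
    (he : ∀ x ∈ U, hat L M a e x = 1) {x : X} (hx : x ∈ U) (v : Tan n x) :
    mvfderiv 𝓘(ℝ, Model n) (hat L M a e) x v = 0 := by
  have h : hat L M a e =ᶠ[𝓝 x] fun _ => 1 := by
    filter_upwards [S.isOpen.mem_nhds hx] with y hy using he y hy
  rw [h.mvfderiv_apply_eq, mvfderiv_const]
  simp

lemma cyclic (S : AlgebraChart L M a U) {e : VField n X}
    (he : ∀ x ∈ U, hat L M a e x = 1) {x : X} (hx : x ∈ U) :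
    LinearIndependent ℝ fun k : Fin n => ((L x) ^ (k : ℕ)) (e x) := by
  have hp : ∀ k : ℕ, mvfderiv 𝓘(ℝ, Model n) (symbol L M a) x (((L x) ^ k) (e x)) = a ^ k := by
    intro k
    induction k with
    | zero => simpa using he x hx
    | succ k ih => rw [pow_succ', mul_apply_eq_comp, S.map_L x hx, ih, pow_succ']
  refine LinearIndependent.of_comp
    (mvfderiv 𝓘(ℝ, Model n) (symbol L M a) x : Tan n x →ₗ[ℝ] R) ?_
  rw [show (mvfderiv 𝓘(ℝ, Model n) (symbol L M a) x : Tan n x →ₗ[ℝ] R) ∘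
    (fun k : Fin n => ((L x) ^ (k : ℕ)) (e x)) = fun k : Fin n => a ^ (k : ℕ) from
    funext fun k => hp k]
  exact S.linearIndependent

/-- Multiplication by the coordinate itself is Nijenhuis: derivatives of the components of V and W
cancel in pairs, and so do the Leibniz terms, all equal to F·dF(V)·dF(W) up to sign. -/
lemma nijenhuis (S : AlgebraChart L M a U) {V W : VField n X}
    (hV : SmoothVFieldOn V U) (hW : SmoothVFieldOn W U) {x : X} (hx : x ∈ U) :
    M x (M x (bracket V W x)) + bracket (app M V) (app M W) x
      - M x (bracket (app M V) W x) - M x (bracket V (app M W) x) = 0 := by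
  have hMV := S.smooth_M.app hV
  have hMW := S.smooth_M.app hW
  apply S.inj hx
  simp only [map_sub, map_add, map_zero, S.map_M hx, S.map_bracket hV hW hx,
    S.map_bracket hMV hMW hx, S.map_bracket hMV hW hx, S.map_bracket hV hMW hx,
    S.mvfderiv_hat_M hV hx, S.mvfderiv_hat_M hW hx]
  ring

lemma lie_L (S : AlgebraChart L M a U) {e : VField n X} (hes : SmoothVFieldOn e U)
    (he : ∀ x ∈ U, hat L M a e x = 1) {V : VField n X}
    (hV : SmoothVFieldOn V U) {x : X} (hx : x ∈ U) :
    bracket e (app L V) x - L x (bracket e V x) = 0 := by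
  have hLV := S.smooth_L.app hV
  apply S.inj hx
  simp only [map_sub, map_zero, S.map_L x hx, S.map_bracket hes hV hx,
    S.map_bracket hes hLV hx, S.mvfderiv_hat_L hV hx, S.mvfderiv_hat_unity he hx]
  ring

lemma lie_M (S : AlgebraChart L M a U) {e : VField n X} (hes : SmoothVFieldOn e U)
    (he : ∀ x ∈ U, hat L M a e x = 1) {V : VField n X}
    (hV : SmoothVFieldOn V U) {x : X} (hx : x ∈ U) :
    bracket e (app M V) x - M x (bracket e V x) = V x := by
  have hMV := S.smooth_M.app hV
  apply S.inj hx
  simp only [map_sub, S.map_M hx, S.map_bracket hes hV hx,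
    S.map_bracket hes hMV hx, S.mvfderiv_hat_M hV hx, S.mvfderiv_hat_unity he hx, he x hx]
  ring

/-- Write ξ̂ = dF(ξ). By Leibniz, P_ξ(ζ,θ) has component -dξ̂(ζ∘θ) + θ̂ dξ̂(ζ) + ζ̂ dξ̂(θ). This is
a derivation in ξ̂, and ξ∘η has component ξ̂η̂. -/
lemma hertling_manin (S : AlgebraChart L M a U) {ξ η ζ θ : VField n X}
    (hξ : SmoothVFieldOn ξ U) (hη : SmoothVFieldOn η U) (hζ : SmoothVFieldOn ζ U)
    (hθ : SmoothVFieldOn θ U) {x : X} (hx : x ∈ U) :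
    bracket (prod (symmetryTensor L M) ξ η) (prod (symmetryTensor L M) ζ θ) x
      - symmetryTensor L M x (bracket (prod (symmetryTensor L M) ξ η) ζ x) (θ x)
      - symmetryTensor L M x (ζ x) (bracket (prod (symmetryTensor L M) ξ η) θ x)
      - symmetryTensor L M x (ξ x) (bracket η (prod (symmetryTensor L M) ζ θ) x)
      + symmetryTensor L M x (symmetryTensor L M x (ξ x) (bracket η ζ x)) (θ x)
      + symmetryTensor L M x (symmetryTensor L M x (ξ x) (ζ x)) (bracket η θ x)
      - symmetryTensor L M x (η x) (bracket ξ (prod (symmetryTensor L M) ζ θ) x)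
      + symmetryTensor L M x (symmetryTensor L M x (η x) (bracket ξ ζ x)) (θ x)
      + symmetryTensor L M x (symmetryTensor L M x (η x) (ζ x)) (bracket ξ θ x) = 0 := by
  have h1 := S.smooth_prod hξ hη
  have h2 := S.smooth_prod hζ hθ
  apply S.inj hx
  simp only [map_sub, map_add, map_zero, S.map_mul hx, S.map_bracket h1 h2 hx,
    S.map_bracket h1 hζ hx, S.map_bracket h1 hθ hx, S.map_bracket hη h2 hx,
    S.map_bracket hξ h2 hx, S.map_bracket hη hζ hx, S.map_bracket hη hθ hx,
    S.map_bracket hξ hζ hx, S.map_bracket hξ hθ hx, S.mvfderiv_hat_prod hξ hη hx,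
    S.mvfderiv_hat_prod hζ hθ hx]
  ring

/-- The component of E is F, so the three brackets contribute -ξ̂η̂ + ξ̂η̂ + ξ̂η̂; the derivatives
along E cancel by Leibniz. -/
lemma euler (S : AlgebraChart L M a U) {e : VField n X} (hes : SmoothVFieldOn e U)
    (he : ∀ x ∈ U, hat L M a e x = 1) {ξ η : VField n X}
    (hξ : SmoothVFieldOn ξ U) (hη : SmoothVFieldOn η U) {x : X} (hx : x ∈ U) :
    bracket (app M e) (prod (symmetryTensor L M) ξ η) x
      - symmetryTensor L M x (bracket (app M e) ξ x) (η x)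
      - symmetryTensor L M x (ξ x) (bracket (app M e) η x)
      = symmetryTensor L M x (ξ x) (η x) := by
  have h1 := S.smooth_prod hξ hη
  have hE := S.smooth_M.app hes
  apply S.inj hx
  simp only [map_sub, S.map_mul hx, S.map_bracket hE h1 hx, S.map_bracket hE hξ hx,
    S.map_bracket hE hη hx, S.mvfderiv_hat_prod hξ hη hx, S.mvfderiv_hat_M hes hx,
    S.mvfderiv_hat_unity he hx, he x hx]
  ring

/-- A vector field `e` with `𝓛_e L = 0` and `𝓛_e M = Id` is the unity of the algebra. -/
lemma hat_eq_one (S : AlgebraChart L M a U) {e : VField n X} (hes : SmoothVFieldOn e U)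
    (hL : LieDerivEq e L fun _ => 0)
    (hM : LieDerivEq e M fun x => ContinuousLinearMap.id ℝ (Tan n x)) {x : X} (hx : x ∈ U) :
    hat L M a e x = 1 := by
  -- The Lie derivative conditions are tested on fields, so tangent vectors are extended by fields
  -- with constant component in R.
  have hfield : ∀ v : Tan n x, ∃ V : VField n X, SmoothVFieldOn V U ∧ V x = v := fun v =>
    ⟨_, smoothVFieldOn_mpullback_const S.isOpen S.smooth_symbol S.bijective
      (mvfderiv 𝓘(ℝ, Model n) (symbol L M a) x v),
      S.inj hx (mvfderiv_mpullback_const (S.bijective x hx) _)⟩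
  -- 𝓛_e L = 0 makes the derivative of ê = dF(e) intertwine `L` with a, hence `M` with F. In the
  -- equation for 𝓛_e M the derivatives of ê then cancel, leaving V̂ ê = V̂; a field with V̂ = 1 at
  -- x gives the claim.
  have h1 : ∀ v : Tan n x, mvfderiv 𝓘(ℝ, Model n) (hat L M a e) x (L x v)
      = a * mvfderiv 𝓘(ℝ, Model n) (hat L M a e) x v := by
    intro v
    obtain ⟨V, hV, rfl⟩ := hfield v
    have := congrArg (mvfderiv 𝓘(ℝ, Model n) (symbol L M a) x) (hL U S.isOpen V hV x hx)
    simp only [map_sub, S.map_L x hx, S.map_bracket hes hV hx,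
      S.map_bracket hes (S.smooth_L.app hV) hx, S.mvfderiv_hat_L hV hx, zero_apply,
      map_zero] at this
    linear_combination -this
  obtain ⟨v, hv⟩ := (S.bijective x hx).2 1
  obtain ⟨V, hV, rfl⟩ := hfield v
  have := congrArg (mvfderiv 𝓘(ℝ, Model n) (symbol L M a) x) (hM U S.isOpen V hV x hx)
  simp only [map_sub, S.map_M hx, S.map_bracket hes hV hx,
    S.map_bracket hes (S.smooth_M.app hV) hx, S.mvfderiv_hat_M hV hx, S.map_op h1,
    ContinuousLinearMap.id_apply, hat, hv] at this
  linear_combination this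

end AlgebraChart

end AlgebraChart

/-! ### Existence of algebra-valued coordinates for a regular symmetry. -/

section Existence

open Filter Topology VectorField

variable {n : ℕ} {X : Type*} [TopologicalSpace X] [ChartedSpace (Model n) X]

instance finiteDimensional_tan (x : X) : FiniteDimensional ℝ (Tan n x) :=
  inferInstanceAs (FiniteDimensional ℝ (Model n))

lemma finrank_tan (x : X) : Module.finrank ℝ (Tan n x) = n :=
  (finrank_euclideanSpace_fin : Module.finrank ℝ (Model n) = n)

lemma IsGlRegular.exists_cyclic {L : OpField n X} (hL : IsGlRegular L) (x : X) :
    ∃ v : Tan n x, LinearIndependent ℝ fun k : Fin n => ((L x) ^ (k : ℕ)) v := by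
  obtain ⟨v, hv⟩ := exists_cyclic_vector (L x : Tan n x →ₗ[ℝ] Tan n x) fun μ => by
    -- gl-regularity constrains eigenvalues only; for any other μ the eigenspace is zero.
    by_cases h : Module.End.HasEigenvalue ((L x : Tan n x →ₗ[ℝ] Tan n x).baseChange ℂ) μ
    · exact (hL x μ h).le
    · rw [Module.End.hasEigenvalue_iff, not_not] at h
      rw [h, finrank_bot]
      exact zero_le_one
  refine ⟨v, ?_⟩
  have := hv.comp (Fin.cast (finrank_tan x).symm) (Fin.cast_injective _)
  convert this using 2 with k
  simp only [Function.comp_apply, Fin.val_cast, ← ContinuousLinearMap.toLinearMap_pow]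
  rfl

/-- Evaluation at a cyclic vector gives both existence and uniqueness of the coefficients, so the
default value in `coeff` never occurs. -/
lemma isExpansionAt_iff {L M : OpField n X} (hL : IsGlRegular L)
    (hM : ∀ x v, L x (M x v) = M x (L x v)) (x : X) (c : Fin n → ℝ) :
    IsExpansionAt L M x c ↔ c = fun i => coeff L M i x := by
  obtain ⟨v, hv⟩ := hL.exists_cyclic x
  have hex : ∃ c : Fin n → ℝ, IsExpansionAt L M x c := exists_eq_sum_pow (finrank_tan x) hv (hM x)
  have hc : IsExpansionAt L M x fun i => coeff L M i x := by
    have : (fun i => coeff L M i x) = hex.choose := by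
      funext i
      rw [coeff, dif_pos hex]
    rw [this]
    exact hex.choose_spec
  refine ⟨fun h => sum_pow_injective hv ?_, fun h => h ▸ hc⟩
  rw [← show M x = _ from h, ← show M x = _ from hc]

/-- `n` linearly independent functionals on an `n`-dimensional space form coordinates. -/
lemma bijective_of_linearIndependent {V : Type*} [AddCommGroup V] [Module ℝ V] [TopologicalSpace V]
    [IsTopologicalAddGroup V] [ContinuousSMul ℝ V] [FiniteDimensional ℝ V]
    (hn : Module.finrank ℝ V = n) {f : Fin n → V →L[ℝ] ℝ} (hf : LinearIndependent ℝ f) :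
    Function.Bijective fun (v : V) i => f i v := by
  let l : V →ₗ[ℝ] Fin n → ℝ := LinearMap.pi fun i => (f i : V →ₗ[ℝ] ℝ)
  have hl : LinearIndependent ℝ fun i => (f i : V →ₗ[ℝ] ℝ) :=
    hf.map' (ContinuousLinearMap.coeLM ℝ)
      (LinearMap.ker_eq_bot.2 ContinuousLinearMap.coe_injective)
  -- The functionals span the dual space, so only the zero vector is killed by all of them.
  have hs := hl.span_eq_top_of_card_eq_finrank' (by simp [Subspace.dual_finrank_eq, hn])
  have hinj : Function.Injective l := by
    rw [← LinearMap.ker_eq_bot, LinearMap.ker_eq_bot']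
    intro v hv
    refine (Module.forall_dual_apply_eq_zero_iff ℝ v).1 fun g => ?_
    have hg : g ∈ Submodule.span ℝ (Set.range fun i => (f i : V →ₗ[ℝ] ℝ)) := hs ▸ Submodule.mem_top
    induction hg using Submodule.span_induction with
    | mem g hg => obtain ⟨i, rfl⟩ := hg; exact congrFun hv i
    | zero => simp
    | add g h _ _ hg hh => simp [hg, hh]
    | smul c g _ hg => simp [hg]
  exact ⟨hinj, (LinearMap.injective_iff_surjective_of_finrank_eq_finrank (by simp [hn])).1 hinj⟩

/-- An operator generates a commutative normed algebra. -/
lemma exists_commAlgebra_of_operator {V : Type} [NormedAddCommGroup V] [NormedSpace ℝ V]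
    (A : V →L[ℝ] V) :
    ∃ (R : Type) (_ : NormedCommRing R) (_ : NormedAlgebra ℝ R) (ι : R →ₐ[ℝ] (V →L[ℝ] V)) (a : R),
      Function.Injective ι ∧ ι a = A := by
  let R := Algebra.adjoin ℝ {A}
  let i₁ : NormedCommRing R :=
    { (inferInstance : NormedRing R) with
      mul_comm := (Algebra.isMulCommutative_adjoin ℝ (s := {A}) (by
        rintro a rfl b rfl; rfl)).is_comm.comm }
  let i₂ : NormedAlgebra ℝ R :=
    { (inferInstance : Algebra ℝ R) with
      norm_smul_le := fun c r => norm_smul_le c (r : V →L[ℝ] V) }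
  refine ⟨R, i₁, i₂, ?_, ⟨A, Algebra.self_mem_adjoin_singleton ℝ A⟩, ?_, ?_⟩
  · exact
      { toFun := Subtype.val
        map_one' := rfl
        map_mul' := fun _ _ => rfl
        map_zero' := rfl
        map_add' := fun _ _ => rfl
        commutes' := fun _ => rfl }
  · exact Subtype.val_injective
  · rfl

lemma algHom_sum_pow {R V : Type*} [NormedCommRing R] [NormedAlgebra ℝ R] [NormedAddCommGroup V]
    [NormedSpace ℝ V] (ι : R →ₐ[ℝ] (V →L[ℝ] V)) (a : R) (c : Fin n → ℝ) :
    ι (∑ i : Fin n, c i • a ^ (n - 1 - (i : ℕ)))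
      = ∑ i : Fin n, c i • (ι a) ^ (n - 1 - (i : ℕ)) := by
  simp only [map_sum, map_smul, map_pow]

lemma linearIndependent_pow_of_cyclic {R V : Type*} [NormedCommRing R] [NormedAlgebra ℝ R]
    [NormedAddCommGroup V] [NormedSpace ℝ V] (ι : R →ₐ[ℝ] (V →L[ℝ] V)) {a : R} {w : V}
    (hw : LinearIndependent ℝ fun k : Fin n => ((ι a) ^ (k : ℕ)) w) :
    LinearIndependent ℝ fun k : Fin n => a ^ (k : ℕ) := by
  rw [Fintype.linearIndependent_iff] at hw ⊢
  intro c hc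
  refine hw c ?_
  have := congrArg (fun r : R => ι r w) hc
  simpa only [map_sum, map_smul, map_pow, sum_apply, smul_apply, map_zero, zero_apply] using this

lemma map_sum_pow_of_semiconj {V W : Type*} [AddCommGroup V] [Module ℝ V] [TopologicalSpace V]
    [IsTopologicalAddGroup V] [ContinuousSMul ℝ V] [AddCommGroup W] [Module ℝ W]
    [TopologicalSpace W] [IsTopologicalAddGroup W] [ContinuousSMul ℝ W]
    {A : V →L[ℝ] V} {A' : W →L[ℝ] W} {D : V →L[ℝ] W}
    (h : ∀ v, D (A v) = A' (D v)) (c : Fin n → ℝ) (v : V) :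
    D ((∑ i : Fin n, c i • A ^ (n - 1 - (i : ℕ))) v)
      = (∑ i : Fin n, c i • A' ^ (n - 1 - (i : ℕ))) (D v) := by
  have hp : ∀ (k : ℕ) v, D ((A ^ k) v) = (A' ^ k) (D v) := by
    intro k
    induction k with
    | zero => simp
    | succ k ih => intro v; rw [pow_succ, mul_apply_eq_comp, ih, h, pow_succ, mul_apply_eq_comp]
  simp only [sum_apply, smul_apply, map_sum, map_smul, hp]

lemma linearIndependent_map_pow {V W : Type*} [AddCommGroup V] [Module ℝ V] [TopologicalSpace V]
    [AddCommGroup W] [Module ℝ W] [TopologicalSpace W]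
    {A : V →L[ℝ] V} {A' : W →L[ℝ] W} {D : V →L[ℝ] W} (h : ∀ v, D (A v) = A' (D v))
    (hD : Function.Injective D) {v : V}
    (hv : LinearIndependent ℝ fun k : Fin n => (A ^ (k : ℕ)) v) :
    LinearIndependent ℝ fun k : Fin n => (A' ^ (k : ℕ)) (D v) := by
  have hp : ∀ (k : ℕ) v, D ((A ^ k) v) = (A' ^ k) (D v) := by
    intro k
    induction k with
    | zero => simp
    | succ k ih => intro v; rw [pow_succ, mul_apply_eq_comp, ih, h, pow_succ, mul_apply_eq_comp]
  have := hv.map' (D : V →ₗ[ℝ] W) (LinearMap.ker_eq_bot.2 hD)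
  rwa [show (D : V →ₗ[ℝ] W) ∘ (fun k : Fin n => (A ^ (k : ℕ)) v)
    = fun k : Fin n => (A' ^ (k : ℕ)) (D v) from funext fun k => hp k v] at this

lemma symmetryTensor_apply (L M : OpField n X) (x : X) (u v : Tan n x) :
    symmetryTensor L M x u v = (∑ i : Fin n,
      differential (n := n) (coeff L M i) x u • (L x) ^ (n - 1 - (i : ℕ))) v := by
  simp only [symmetryTensor, sum_apply]
  rfl

/-- A chart in which `L` is the constant operator `A`. -/
structure IsConstantChart (L : OpField n X) (φ : OpenPartialHomeomorph X (Model n))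
    (A : Model n →L[ℝ] Model n) : Prop where
  mem : φ ∈ IsManifold.maximalAtlas 𝓘(ℝ, Model n) ∞ X
  map_L : ∀ x ∈ φ.source, ∀ v : Tan n x,
    mvfderiv 𝓘(ℝ, Model n) φ x (L x v) = A (mvfderiv 𝓘(ℝ, Model n) φ x v)

namespace IsConstantChart

variable {L M : OpField n X} {φ : OpenPartialHomeomorph X (Model n)} {A : Model n →L[ℝ] Model n}

lemma smooth (C : IsConstantChart L φ A) :
    ContMDiffOn 𝓘(ℝ, Model n) 𝓘(ℝ, Model n) ∞ φ φ.source :=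
  contMDiffOn_of_mem_maximalAtlas C.mem

lemma bijective (C : IsConstantChart L φ A) {x : X} (hx : x ∈ φ.source) :
    Function.Bijective (mvfderiv 𝓘(ℝ, Model n) φ x) :=
  mvfderiv_chart_bijective C.mem hx

/-- The vector field with constant coordinates `c`. -/
abbrev _root_.NijenhuisF.constField (φ : OpenPartialHomeomorph X (Model n)) (c : Model n) :
    VField n X :=
  mpullback 𝓘(ℝ, Model n) 𝓘(ℝ, Model n) φ fun _ => c

lemma map_op (C : IsConstantChart L φ A)
    (hE : ∀ x, IsExpansionAt L M x fun i => coeff L M i x) {x : X} (hx : x ∈ φ.source)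
    (v : Tan n x) :
    mvfderiv 𝓘(ℝ, Model n) φ x (M x v)
      = (∑ i : Fin n, coeff L M i x • A ^ (n - 1 - (i : ℕ))) (mvfderiv 𝓘(ℝ, Model n) φ x v) := by
  rw [show M x = _ from hE x, map_sum_pow_of_semiconj (C.map_L x hx)]

lemma map_constField (C : IsConstantChart L φ A) (c : Model n) {x : X} (hx : x ∈ φ.source) :
    mvfderiv 𝓘(ℝ, Model n) φ x (constField φ c x) = c :=
  mvfderiv_mpullback_const (C.bijective hx) c

variable [IsManifold 𝓘(ℝ, Model n) ∞ X]

lemma smooth_constField (C : IsConstantChart L φ A) (c : Model n) :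
    SmoothVFieldOn (constField φ c) φ.source :=
  smoothVFieldOn_mpullback_const φ.open_source C.smooth (fun _ hx => C.bijective hx) c

/-- Applied to the constant field `w`, `M` reads Σ g_i A^(n-1-i) w in the chart: the g_i are
coordinates of a smooth function in a fixed basis. -/
lemma smooth_coeff (C : IsConstantChart L φ A) (hMs : SmoothOpField M)
    (hE : ∀ x, IsExpansionAt L M x fun i => coeff L M i x) {w : Model n}
    (hw : LinearIndependent ℝ fun k : Fin n => (A ^ (k : ℕ)) w) (i : Fin n) :
    ContMDiffOn 𝓘(ℝ, Model n) 𝓘(ℝ, ℝ) ∞ (coeff L M i) φ.source := by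
  let b := basisOfLinearIndependentOfCardEqFinrank' _ (linearIndependent_rev_of_cyclic hw)
    (by simp)
  have h := contMDiffOn_mvfderiv_apply φ.open_source C.smooth (hMs.app (C.smooth_constField w))
  refine ((b.coord i).toContinuousLinearMap.contMDiff.comp_contMDiffOn h).congr fun x hx => ?_
  have hb : mvfderiv 𝓘(ℝ, Model n) φ x (app M (constField φ w) x)
      = ∑ j, coeff L M j x • b j := by
    rw [C.map_op hE hx, C.map_constField w hx, sum_apply]
    simp only [smul_apply, b, coe_basisOfLinearIndependentOfCardEqFinrank']
  rw [Function.comp_apply, hb]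
  change _ = b.coord i _
  rw [Module.Basis.coord_apply, b.repr_sum_self]

/-- For a constant field V, both V and LV have constant coordinates, so [LV,V] = [V,V] = 0, while
only the g_i get differentiated in [V,MV] = T_M(V,V) and [LV,MV] = T_M(LV,V). The symmetry condition
on V then becomes the claim. -/
lemma tensor_diag (C : IsConstantChart L φ A) (hLs : SmoothOpField L) (hMs : SmoothOpField M)
    (hE : ∀ x, IsExpansionAt L M x fun i => coeff L M i x) (hM : IsSymmetry L M)
    (hc : ∀ i, ContMDiffOn 𝓘(ℝ, Model n) 𝓘(ℝ, ℝ) ∞ (coeff L M i) φ.source)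
    {x : X} (hx : x ∈ φ.source) (u : Tan n x) :
    L x (symmetryTensor L M x u u) = symmetryTensor L M x (L x u) u := by
  set c := mvfderiv 𝓘(ℝ, Model n) φ x u with hcu
  set V := constField φ c with hVdef
  have hV : SmoothVFieldOn V φ.source := C.smooth_constField c
  have hVx : V x = u := (C.bijective hx).1 (C.map_constField c hx)
  have hU := φ.open_source
  have hd : ∀ (Z : VField n X) (c : Model n),
      (∀ y ∈ φ.source, mvfderiv 𝓘(ℝ, Model n) φ y (Z y) = c) → ∀ v,
      mvfderiv 𝓘(ℝ, Model n) (fun y => mvfderiv 𝓘(ℝ, Model n) φ y (Z y)) x v = 0 := by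
    intro Z c hZ v
    have : (fun y => mvfderiv 𝓘(ℝ, Model n) φ y (Z y)) =ᶠ[𝓝 x] fun _ => c := by
      filter_upwards [hU.mem_nhds hx] with y hy using hZ y hy
    rw [this.mvfderiv_apply_eq, mvfderiv_const]
    simp
  have hdV := hd V c fun y hy => C.map_constField c hy
  have hdL := hd (app L V) (A c) fun y hy => by rw [C.map_L y hy, C.map_constField c hy]
  have hdM : ∀ v, mvfderiv 𝓘(ℝ, Model n)
      (fun y => mvfderiv 𝓘(ℝ, Model n) φ y (app M V y)) x v
        = mvfderiv 𝓘(ℝ, Model n) φ x (symmetryTensor L M x v u) := by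
    intro v
    let l (i : Fin n) : ℝ →L[ℝ] Model n :=
      (ContinuousLinearMap.id ℝ ℝ).smulRight ((A ^ (n - 1 - (i : ℕ))) c)
    have h1 : (fun y => mvfderiv 𝓘(ℝ, Model n) φ y (app M V y)) =ᶠ[𝓝 x]
        fun y => ∑ i : Fin n, l i (coeff L M i y) := by
      filter_upwards [hU.mem_nhds hx] with y hy
      rw [C.map_op hE hy, C.map_constField c hy, sum_apply]
      rfl
    have hci i := mdifferentiableAt_of_contMDiffOn hU (hc i) hx
    rw [h1.mvfderiv_apply_eq, mvfderiv_finset_sum Finset.univ (f := fun i y => l i (coeff L M i y))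
      (fun i => (l i).mdifferentiableAt.comp (I' := 𝓘(ℝ, ℝ)) x (hci i)),
      symmetryTensor_apply, map_sum_pow_of_semiconj (C.map_L x hx), sum_apply]
    exact Finset.sum_congr rfl fun i _ => mvfderiv_clm_comp (l i) (hci i) v
  have hbr {Y Z : VField n X} (hY : SmoothVFieldOn Y φ.source) (hZ : SmoothVFieldOn Z φ.source) :=
    mvfderiv_bracket hU C.smooth hY hZ hx
  have hLV := hLs.app hV
  have hMV := hMs.app hV
  have e1 : bracket (app L V) V x = 0 := (C.bijective hx).1 (by
    rw [hbr hLV hV, hdV, hdL, map_zero, sub_zero])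
  have e2 : bracket V V x = 0 := (C.bijective hx).1 (by
    rw [hbr hV hV, hdV, map_zero, sub_zero])
  have e3 : bracket V (app M V) x = symmetryTensor L M x u u := (C.bijective hx).1 (by
    rw [hbr hV hMV, hdV, hdM, sub_zero, hVx])
  have e4 : bracket (app L V) (app M V) x = symmetryTensor L M x (L x u) u :=
    (C.bijective hx).1 (by rw [hbr hLV hMV, hdL, hdM, sub_zero, app, hVx])
  have := hM.2 φ.source hU V hV x hx
  rw [nijBracket, e1, e2, e3, e4] at this
  simpa [sub_eq_zero] using this

/-- In a chart where `L` is constant, a regular symmetry defines coordinates with values in the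
algebra generated by `L`. -/
lemma algebraChart {R : Type*} [NormedCommRing R] [NormedAlgebra ℝ R]
    {ι : R →ₐ[ℝ] (Model n →L[ℝ] Model n)} (hι : Function.Injective ι) {a : R}
    (C : IsConstantChart L φ (ι a)) (hLs : SmoothOpField L) (hMs : SmoothOpField M)
    (hE : ∀ x, IsExpansionAt L M x fun i => coeff L M i x) (hM : IsRegularSymmetry L M)
    (hreg : IsGlRegular L) (hne : φ.source.Nonempty) :
    AlgebraChart L M a φ.source := by
  obtain ⟨p, hp⟩ := hne
  -- A cyclic vector of `L` at one point of the chart, transported by dφ, is cyclic for the constant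
  -- operator.
  obtain ⟨w, hw⟩ : ∃ w, LinearIndependent ℝ fun k : Fin n => ((ι a) ^ (k : ℕ)) w := by
    obtain ⟨v, hv⟩ := hreg.exists_cyclic p
    exact ⟨_, linearIndependent_map_pow (C.map_L p hp) (C.bijective hp).1 hv⟩
  have hc := C.smooth_coeff hMs hE hw
  have hT : ∀ x ∈ φ.source, ∀ u v, symmetryTensor L M x (L x u) v
      = L x (symmetryTensor L M x u v) := by
    intro x hx
    obtain ⟨v, hv⟩ := hreg.exists_cyclic x
    refine bilin_linear_left_of_diag (finrank_tan x) hv _ (fun u w => ?_)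
      (C.tensor_diag hLs hMs hE hM.1 hc hx)
    rw [symmetryTensor_apply, symmetryTensor_apply, commute_sum_pow]
  have hdF : ∀ x ∈ φ.source, ∀ u : Tan n x,
      mvfderiv 𝓘(ℝ, Model n) (symbol L M a) x u
        = ∑ i : Fin n, differential (n := n) (coeff L M i) x u
            • a ^ (n - 1 - (i : ℕ)) := fun x hx u =>
    mvfderiv_symbol (fun i => mdifferentiableAt_of_contMDiffOn φ.open_source (hc i) hx) u
  -- Acting on the model space, dF(u) is the operator T_M(u,·) seen in the chart, so L-linearity of
  -- T_M in u turns into dF(Lu) = a dF(u).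
  have hact : ∀ x ∈ φ.source, ∀ u v : Tan n x,
      ι (mvfderiv 𝓘(ℝ, Model n) (symbol L M a) x u) (mvfderiv 𝓘(ℝ, Model n) φ x v)
        = mvfderiv 𝓘(ℝ, Model n) φ x (symmetryTensor L M x u v) := by
    intro x hx u v
    rw [hdF x hx, algHom_sum_pow, symmetryTensor_apply,
      map_sum_pow_of_semiconj (C.map_L x hx)]
  refine ⟨φ.open_source, hLs, hMs, hE, hc, fun x hx => ?_, fun x hx v => ?_, ?_⟩
  · have hb := bijective_of_linearIndependent (finrank_tan x) (hM.2 x)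
    constructor
    · intro u v huv
      refine hb.1 (sum_pow_injective hw ?_)
      rw [hdF x hx, hdF x hx] at huv
      rw [← algHom_sum_pow, ← algHom_sum_pow, huv]
    · intro r
      -- Every element of R commutes with the cyclic operator `ι a`, hence is a polynomial in it of
      -- degree below n; the c_i are attained as values dg_i(u).
      obtain ⟨c, hc'⟩ := exists_eq_sum_pow (A := ι a) (B := ι r) (by simp) hw fun v =>
        DFunLike.congr_fun (show ι a * ι r = ι r * ι a by
          rw [← map_mul, ← map_mul, mul_comm]) v
      obtain ⟨u, hu⟩ := hb.2 c
      refine ⟨u, hι ?_⟩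
      rw [hdF x hx, hc', ← hu, algHom_sum_pow]
  · apply hι
    ext1 y
    obtain ⟨z, rfl⟩ := (C.bijective hx).2 y
    rw [hact x hx, hT x hx, C.map_L x hx, ← hact x hx, map_mul, mul_apply_eq_comp]
  · exact linearIndependent_pow_of_cyclic ι hw

end IsConstantChart

lemma IsConstantInCoordinates.exists_algebraChart [IsManifold 𝓘(ℝ, Model n) ∞ X] {L M : OpField n X}
    (hL : IsConstantInCoordinates L) (hLs : SmoothOpField L) (hMs : SmoothOpField M)
    (hE : ∀ x, IsExpansionAt L M x fun i => coeff L M i x) (hM : IsRegularSymmetry L M)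
    (hreg : IsGlRegular L) (p : X) :
    ∃ (R : Type) (_ : NormedCommRing R) (_ : NormedAlgebra ℝ R) (a : R) (U : Set X),
      p ∈ U ∧ AlgebraChart L M a U := by
  obtain ⟨φ, hφ, hp, A, hA⟩ := hL p
  obtain ⟨R, i₁, i₂, ι, a, hι, rfl⟩ := exists_commAlgebra_of_operator A
  have C : IsConstantChart L φ (ι a) := ⟨hφ, hA⟩
  exact ⟨R, i₁, i₂, a, φ.source, hp, C.algebraChart hι hLs hMs hE hM hreg ⟨p, hp⟩⟩

end Existence

end NijenhuisF

end

/-! ### From local charts to the global statement. -/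

open NijenhuisF in
theorem proposition3p4 {n : ℕ} {X : Type*} [TopologicalSpace X] [ChartedSpace (Model n) X]
    [IsManifold 𝓘(ℝ, Model n) ∞ X]
    (L M : OpField n X) (hLs : SmoothOpField L) (hMs : SmoothOpField M)
    (hLN : IsNijenhuis L) (hLreg : IsGlRegular L) (hLconst : IsConstantInCoordinates L)
    (hM : IsRegularSymmetry L M) :
    (∀ x, ∀ c : Fin n → ℝ, IsExpansionAt L M x c ↔ c = fun i => coeff L M i x) ∧
    (∃! e : VField n X, IsUnityFor L M e) ∧
    (∀ e : VField n X, IsUnityFor L M e →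
      IsFManifold (symmetryTensor L M) e (app M e) ∧ IsNijenhuis M) := by
  have hexp := isExpansionAt_iff hLreg hM.1.1
  have hE : ∀ x, IsExpansionAt L M x fun i => coeff L M i x := fun x => (hexp x _).2 rfl
  have hchart := hLconst.exists_algebraChart hLs hMs hE hM hLreg
  have hcoeff : ∀ i, ContMDiff 𝓘(ℝ, Model n) 𝓘(ℝ, ℝ) ∞ (coeff L M i) := fun i x => by
    obtain ⟨R, _, _, a, U, hx, S⟩ := hchart x
    exact (S.smooth_coeff i).contMDiffAt (S.isOpen.mem_nhds hx)
  refine ⟨hexp, ?_, fun e he => ⟨⟨?_, he.smooth, ?_, ?_, ?_, ?_, ?_, ?_⟩, ?_⟩⟩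
  -- The unity is defined pointwise by T_M, which does not refer to a chart, so no gluing is needed.
  -- Charts serve only to show that it exists and is smooth, being locally the pullback of the
  -- constant 1.
  · have hunit : ∀ x : X, ∃ v : Tan n x, ∀ w, symmetryTensor L M x v w = w := fun x => by
      obtain ⟨R, _, _, a, U, hx, S⟩ := hchart x
      obtain ⟨v, hv⟩ := (S.bijective x hx).2 1
      exact ⟨v, fun w => S.inj hx (by rw [S.map_mul hx, hv, one_mul])⟩
    choose e he using hunit
    have hhat : ∀ {R : Type} [NormedCommRing R] [NormedAlgebra ℝ R] {a : R} {U : Set X},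
        AlgebraChart L M a U → ∀ x ∈ U, hat L M a e x = 1 := by
      intro R _ _ a U S x hx
      obtain ⟨v, hv⟩ := (S.bijective x hx).2 1
      have := S.map_mul hx (e x) v
      rw [he, hv, mul_one] at this
      exact this.symm
    have hes : SmoothVField e := fun x => by
      obtain ⟨R, _, _, a, U, hx, S⟩ := hchart x
      have h := smoothVFieldOn_mpullback_const S.isOpen S.smooth_symbol S.bijective 1
      refine (h.congr fun y hy => ?_).contMDiffAt (S.isOpen.mem_nhds hx)
      congr 1
      exact S.inj hy ((hhat S y hy).trans (mvfderiv_mpullback_const (S.bijective y hy) 1).symm)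
    refine ⟨e, ⟨hes, fun x => ?_, fun U' hU' V hV x hx' => ?_, fun U' hU' V hV x hx' => ?_⟩,
      fun e' he' => ?_⟩
    · obtain ⟨R, _, _, a, U, hx, S⟩ := hchart x
      exact S.cyclic (hhat S) hx
    · obtain ⟨R, _, _, a, U, hx, S⟩ := hchart x
      -- Test fields are smooth only on `U'`, so the chart is shrunk to the intersection.
      have S' := S.mono (S.isOpen.inter hU') Set.inter_subset_left
      exact S'.lie_L hes.contMDiffOn (hhat S') (hV.mono Set.inter_subset_right) ⟨hx, hx'⟩
    · obtain ⟨R, _, _, a, U, hx, S⟩ := hchart x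
      have S' := S.mono (S.isOpen.inter hU') Set.inter_subset_left
      exact S'.lie_M hes.contMDiffOn (hhat S') (hV.mono Set.inter_subset_right) ⟨hx, hx'⟩
    · funext x
      obtain ⟨R, _, _, a, U, hx, S⟩ := hchart x
      exact S.inj hx ((S.hat_eq_one he'.smooth.contMDiffOn he'.lie_L he'.lie_M hx).trans
        (hhat S x hx).symm)
  · intro U hU V W hV hW
    exact smoothVFieldOn_symmetryTensor hLs hU (fun i => (hcoeff i).contMDiffOn) hV hW
  · have := hMs.app (U := Set.univ) (V := e) he.smooth.contMDiffOn
    exact contMDiffOn_univ.1 this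
  · intro x u v
    obtain ⟨R, _, _, a, U, hx, S⟩ := hchart x
    exact S.inj hx (by rw [S.map_mul hx, S.map_mul hx, mul_comm])
  · intro x u v w
    obtain ⟨R, _, _, a, U, hx, S⟩ := hchart x
    exact S.inj hx (by simp only [S.map_mul hx, mul_assoc])
  · intro x v
    obtain ⟨R, _, _, a, U, hx, S⟩ := hchart x
    have h1 : mvfderiv 𝓘(ℝ, Model n) (symbol L M a) x (e x) = 1 :=
      S.hat_eq_one he.smooth.contMDiffOn he.lie_L he.lie_M hx
    exact S.inj hx (by rw [S.map_mul hx, h1, one_mul])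
  · intro U' hU' ξ η ζ θ hξ hη hζ hθ x hx'
    obtain ⟨R, _, _, a, U, hx, S⟩ := hchart x
    have S' := S.mono (S.isOpen.inter hU') Set.inter_subset_left
    have r := Set.inter_subset_right (s := U) (t := U')
    exact S'.hertling_manin (hξ.mono r) (hη.mono r) (hζ.mono r) (hθ.mono r) ⟨hx, hx'⟩
  · intro U' hU' ξ η hξ hη x hx'
    obtain ⟨R, _, _, a, U, hx, S⟩ := hchart x
    have S' := S.mono (S.isOpen.inter hU') Set.inter_subset_left
    have r := Set.inter_subset_right (s := U) (t := U')
    exact S'.euler he.smooth.contMDiffOn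
      (fun y hy => S'.hat_eq_one he.smooth.contMDiffOn he.lie_L he.lie_M hy)
      (hξ.mono r) (hη.mono r) ⟨hx, hx'⟩
  · intro U' hU' V W hV hW x hx'
    obtain ⟨R, _, _, a, U, hx, S⟩ := hchart x
    have S' := S.mono (S.isOpen.inter hU') Set.inter_subset_left
    have r := Set.inter_subset_right (s := U) (t := U')
    exact S'.nijenhuis (hV.mono r) (hW.mono r) ⟨hx, hx'⟩
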